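/- **Setting.** For $a_1,\dots,a_n\in\mathbb R^d$ with $\|a_i\|_2\le 1$, labels $y_i\in\{-1,1\}$ and $\mu>0$, let $$f(x)=\frac1n\sum_{i=1}^n\log\bigl(1+e^{-y_i x^\top a_i}\bigr)+\frac{\mu}{2}\|x\|_2^2,\qquad \lambda(x)=\sqrt{\nabla f(x)^\top(\nabla^2f(x))^{-1}\nabla f(x)},\qquad \kappa_f=\sup_{x\in\mathbb R^d}\kappa(\nabla^2 f(x)),$$ where $\kappa(M)=\|M\|_2\|M^{-1}\|_2$ is the condition number. A *Transformer layer with linear attention and ReLU* acts on matrices $H\in\mathbb R^{D\times n}$ (whose columns are the tokens) by $$\mathrm{Attn}(H)=H+\sum_{h=1}^{m}W_V^{(h)}H\,(W_K^{(h)}H)^\top(W_Q^{(h)}H),\qquad \mathrm{TF}(H)=\mathrm{Attn}(H)+W_2\,\mathrm{ReLU}\bigl(W_1\mathrm{Attn}(H)\bigr),$$ with $W_V^{(h)},W_K^{(h)},W_Q^{(h)}\in\mathbb R^{D\times D}$, $W_1\in\mathbb R^{N\times D}$, $W_2\in\mathbb R^{D\times N}$. Its width is $\max(D,N)$. A Transformer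 is a composition of finitely many such layers (the numbers $m$ and $N$ may vary from layer to layer); its depth is the number of layers and its width is the largest width of a layer. For $d\le n$ and $x\in\mathbb R^d$ let $H(A,y,x)\in\mathbb R^{(7d+5)\times n}$ be the matrix with the row blocks $$[I_d\ 0],\ [I_d\ 0],\ [I_d\ 0],\ 0_{(2d+1)\times n},\ A^\top=[a_1,\dots,a_n],\ y^\top,\ x\mathbf 1_n^\top,\ \tfrac1n e_1^\top,\ 0,\ \mathbf 1_n^\top .$$ **Theorem.** For every $C>0$ there are constants $K,\varepsilon_0>0$, depending only on $C$, such that the following holds for all integers $1\le d\le n$, all $\mu>0$, $\kappa\ge1$ and $\varepsilon>0$. Put $\delta=\min\{\varepsilon,\varepsilon_0/(1+\mu)\}$ (so $\delta=\varepsilon$ when $\varepsilon$ is small enough). There are an integer $k\ge0$ with $$k\le 2\log_2\kappa+\log_2\log_2\frac{(1+\mu)^3}{\delta^2\mu^2}$$ and a Transformer with linear attention and ReLU layers, of depth $11+2k$, with at most $K$ attention heads per layer and of width at most $$K\,d\,\frac{(1+\mu)^8}{\delta^4\mu^{10}},$$ such that for all data $a_1,\dots,a_n$ with $\|a_i\|_2\le1$,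 all $y\in\{-1,1\}^n$ with $\kappa_f\le\kappa$, and all $x_0\in\mathbb R^d$ with $\|x_0\|_2\le C$, the Transformer maps $H(A,y,x_0)$ to $H(A,y,x_1)$ for some $x_1\in\mathbb R^d$ satisfying $$\Bigl\|x_1-\Bigl(x_0-\frac{2\sqrt\mu}{2\sqrt\mu+\lambda(x_0)}\,(\nabla^2f(x_0))^{-1}\nabla f(x_0)\Bigr)\Bigr\|_2\le\varepsilon .$$ -/

import Mathlib

open scoped RealInnerProductSpace

noncomputable section

/-! ### The regularized logistic loss and the damped Newton step -/

/-- The regularized logistic loss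
`f(w) = (1/n) ∑ᵢ log (1 + exp (-yᵢ wᵀaᵢ)) + (μ/2) ‖w‖₂²` of the data `(aᵢ, yᵢ)`. -/
def logisticLoss {d n : ℕ} (μ : ℝ) (a : Fin n → EuclideanSpace ℝ (Fin d)) (y : Fin n → ℝ)
    (w : EuclideanSpace ℝ (Fin d)) : ℝ :=
  (1 / (n : ℝ)) * ∑ i, Real.log (1 + Real.exp (-(y i) * ⟪w, a i⟫)) + μ / 2 * ‖w‖ ^ 2

/-- The Hessian `∇²f(x)`, as an operator on `ℝᵈ`: the derivative of the gradient. -/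
def hessian {d : ℕ} (f : EuclideanSpace ℝ (Fin d) → ℝ) (x : EuclideanSpace ℝ (Fin d)) :
    EuclideanSpace ℝ (Fin d) →L[ℝ] EuclideanSpace ℝ (Fin d) :=
  fderiv ℝ (gradient f) x

/-- The Newton direction `(∇²f(x))⁻¹ ∇f(x)`. -/
def newtonDirection {d : ℕ} (f : EuclideanSpace ℝ (Fin d) → ℝ) (x : EuclideanSpace ℝ (Fin d)) :
    EuclideanSpace ℝ (Fin d) :=
  (hessian f x).inverse (gradient f x)

/-- The Newton decrement `λ(x) = (∇f(x)ᵀ (∇²f(x))⁻¹ ∇f(x))^{1/2}`. -/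
def newtonDecrement {d : ℕ} (f : EuclideanSpace ℝ (Fin d) → ℝ)
    (x : EuclideanSpace ℝ (Fin d)) : ℝ :=
  Real.sqrt ⟪gradient f x, newtonDirection f x⟫

/-- The damped Newton update `x - 2√μ / (2√μ + λ(x)) · (∇²f(x))⁻¹ ∇f(x)`. -/
def dampedNewtonStep {d : ℕ} (μ : ℝ) (f : EuclideanSpace ℝ (Fin d) → ℝ)
    (x : EuclideanSpace ℝ (Fin d)) : EuclideanSpace ℝ (Fin d) :=
  x - (2 * Real.sqrt μ / (2 * Real.sqrt μ + newtonDecrement f x)) • newtonDirection f x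

/-- The condition number `‖A‖₂ ‖A⁻¹‖₂ = σ_max(A) / σ_min(A)` of an invertible operator `A`
(the norm of an operator on Euclidean space is the spectral norm). -/
def conditionNumber {d : ℕ}
    (A : EuclideanSpace ℝ (Fin d) →L[ℝ] EuclideanSpace ℝ (Fin d)) : ℝ :=
  ‖A‖ * ‖A.inverse‖

/-- `κ_f`, the supremum over all `x` of the condition number of `∇²f(x)`. -/
def lossConditionNumber {d : ℕ} (f : EuclideanSpace ℝ (Fin d) → ℝ) : ℝ :=
  ⨆ x, conditionNumber (hessian f x)

/-! ### Transformers with linear attention and ReLU layers -/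

/-- The weights of one Transformer layer acting on tokens with coordinates indexed by `ι`:
value, key and query matrices of every attention head, and the two weight matrices of the
feed-forward network. -/
structure TransformerLayer (ι : Type) where
  /-- number of attention heads -/
  heads : ℕ
  /-- number of ReLU neurons of the feed-forward network -/
  hidden : ℕ
  /-- value matrices -/
  WV : Fin heads → Matrix ι ι ℝ
  /-- key matrices -/
  WK : Fin heads → Matrix ι ι ℝ
  /-- query matrices -/
  WQ : Fin heads → Matrix ι ι ℝ
  /-- input weights of the feed-forward network -/
  W1 : Matrix (Fin hidden) ι ℝ
  /-- output weights of the feed-forward network -/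
  W2 : Matrix ι (Fin hidden) ℝ

namespace TransformerLayer

variable {ι : Type} [Fintype ι] {n : ℕ}

/-- Linear attention with a residual connection,
`Attn(H) = H + ∑ᵢ (W_V⁽ⁱ⁾ H) (W_K⁽ⁱ⁾ H)ᵀ (W_Q⁽ⁱ⁾ H)`; the columns of `H` are the tokens. -/
def attn (L : TransformerLayer ι) (H : Matrix ι (Fin n) ℝ) : Matrix ι (Fin n) ℝ :=
  H + ∑ i, (L.WV i * H) * (L.WK i * H).transpose * (L.WQ i * H)

/-- The output `TF(H) = Attn(H) + W₂ ReLU(W₁ Attn(H))` of the layer. -/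
def eval (L : TransformerLayer ι) (H : Matrix ι (Fin n) ℝ) : Matrix ι (Fin n) ℝ :=
  L.attn H + L.W2 * (L.W1 * L.attn H).map (fun t => max t 0)

/-- The width of a layer: the larger of the token dimension and the number of ReLU neurons. -/
def width (L : TransformerLayer ι) : ℕ :=
  max (Fintype.card ι) L.hidden

end TransformerLayer

/-- A Transformer is a finite sequence of layers; its depth is the length of the sequence. -/
abbrev LinearTransformer (ι : Type) : Type := List (TransformerLayer ι)

/-- The composition of the layers, the head of the list being applied first. -/
def LinearTransformer.eval {ι : Type} [Fintype ι] {n : ℕ} (T : LinearTransformer ι)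
    (H : Matrix ι (Fin n) ℝ) : Matrix ι (Fin n) ℝ :=
  T.foldl (fun G L => L.eval G) H

/-! ### Input and output format -/

/-- The `7d + 5` coordinates of a token: three blocks of `d` rows for `[I_d 0]` and `2d + 1` rows
of zeros; `d` rows for `Aᵀ` and `d` rows for the iterate; four single rows (labels, `e₁ᵀ / n`,
the step-size row, ones). -/
abbrev TokenRow (d : ℕ) : Type :=
  ((Fin 3 × Fin d) ⊕ Fin (2 * d + 1)) ⊕ ((Fin d ⊕ Fin d) ⊕ Fin 4)

/-- The `(7d + 5) × n` matrix with the row blocks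
`[I_d 0]`, `[I_d 0]`, `[I_d 0]`, `0`, `Aᵀ`, `yᵀ`, `x 1ₙᵀ`, `e₁ᵀ / n`, `0`, `1ₙᵀ`,
where the columns of `Aᵀ` are the covariates `aⱼ`. -/
def contextMatrix {d n : ℕ} (a : Fin n → EuclideanSpace ℝ (Fin d)) (y : Fin n → ℝ)
    (x : EuclideanSpace ℝ (Fin d)) : Matrix (TokenRow d) (Fin n) ℝ
  | .inl (.inl (_, i)), j => if (i : ℕ) = (j : ℕ) then 1 else 0
  | .inl (.inr _), _ => 0
  | .inr (.inl (.inl i)), j => a j i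
  | .inr (.inl (.inr i)), _ => x i
  | .inr (.inr 0), j => y j
  | .inr (.inr 1), j => if (j : ℕ) = 0 then 1 / (n : ℝ) else 0
  | .inr (.inr 2), _ => 0
  | .inr (.inr 3), _ => 1

end

open scoped RealInnerProductSpace

/-! ### Realizable feed-forward and attention maps -/

/-! The Newton step is a short arithmetic program. Linear attention performs its matrix products,
and ReLU networks its scalar nonlinearities.

Write `J = [I_d 0]`. Since `d ≤ n`, `J Jᵀ = 1`, so one head acting on blocks `X J`, `Y J`, `Z`
produces `X Yᵀ Z` (`mul_eyeBlock_mul`). ReLU networks here have no biases; the row of ones supplies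
them. The nonlinear ingredients are products `φ(s) a` with `|a| ≤ 1`. A piecewise constant `φ` is a
telescoping sum of jumps, and a pair of neurons switches each jump on as `s` crosses a mesh cell
(`exists_gated_product`). The resulting error is at most `τ |a|`. Applied to the coordinates of
`aⱼ`, it bounds vector errors without any loss in the dimension.

With `φ = σ` and `φ = σ'` evaluated at the margins `⟨x, aⱼ⟩`, the heads assemble an approximate
gradient `g` and an approximate Hessian `M`. The latter is symmetrized, so the transposes forced by
attention are harmless. It is inverted by repeated squaring: from `M X = 1 - R`, the update `X ↦ X +
X R`, `R ↦ R²` preserves the identity. The start is `X = α`, `R = 1 - α M`, with `α` close to `1 /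
(2κh)` and `h` the first diagonal entry of `M`. Up to a small error `h` is a Rayleigh quotient of
the Hessian, hence within a factor `κ` of both extreme eigenvalues. This gives `‖R‖ ≤ 1 - 1/(5κ²)`
(`norm_residual_le`), and `2k` squarings, with `2^k` of order `κ² log Y`, make the residual at most
`Y⁻³` (`exists_squaring_steps`).

`newton_perturbation` turns the errors in `M`, `g` and the residual into errors of the direction and
of `λ²`. The damping factor is only Hölder-1/2 in `λ²` (`abs_damping_sub_le`), so `λ²` must be known
to accuracy of order `δ²`. `norm_newton_step_sub_le` combines the errors, and `precision_bounds`
checks that the chosen precisions suffice and are affordable. -/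

/-- `g` is computed by a one-hidden-layer ReLU network with at most `N` neurons. -/
def IsReluNet {ι : Type} [Fintype ι] (N : ℕ) (g : (ι → ℝ) → ℝ) : Prop :=
  ∃ (m : ℕ) (w : Fin m → ι → ℝ) (c : Fin m → ℝ), m ≤ N ∧
    ∀ u, g u = ∑ k, c k * max (w k ⬝ᵥ u) 0

namespace IsReluNet

variable {ι : Type} [Fintype ι] {N N₁ N₂ : ℕ} {g g₁ g₂ : (ι → ℝ) → ℝ}

theorem mono (h : IsReluNet N₁ g) (hN : N₁ ≤ N₂) : IsReluNet N₂ g := by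
  obtain ⟨m, w, c, hm, hg⟩ := h
  exact ⟨m, w, c, hm.trans hN, hg⟩

theorem zero : IsReluNet 0 (fun _ : ι → ℝ => 0) :=
  ⟨0, fun _ _ => 0, fun _ => 0, le_rfl, fun u => by simp⟩

theorem relu (w : ι → ℝ) (c : ℝ) : IsReluNet 1 (fun u => c * max (w ⬝ᵥ u) 0) :=
  ⟨1, fun _ => w, fun _ => c, le_rfl, fun u => by simp⟩

theorem add (h₁ : IsReluNet N₁ g₁) (h₂ : IsReluNet N₂ g₂) :
    IsReluNet (N₁ + N₂) (fun u => g₁ u + g₂ u) := by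
  obtain ⟨m₁, w₁, c₁, hm₁, hg₁⟩ := h₁
  obtain ⟨m₂, w₂, c₂, hm₂, hg₂⟩ := h₂
  refine ⟨m₁ + m₂, Fin.append w₁ w₂, Fin.append c₁ c₂, by omega, fun u => ?_⟩
  simp [Fin.sum_univ_add, hg₁, hg₂]

theorem sum {K : ℕ} {f : ℕ → (ι → ℝ) → ℝ} (hf : ∀ k, IsReluNet N (f k)) :
    IsReluNet (K * N) (fun u => ∑ k ∈ Finset.range K, f k u) := by
  induction K with
  | zero => simpa using zero
  | succ K ih =>
    simp only [Finset.sum_range_succ, Nat.succ_mul]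
    exact ih.add (hf K)

theorem linear (w : ι → ℝ) : IsReluNet 2 (fun u => w ⬝ᵥ u) := by
  have h := (relu w 1).add (relu (-w) (-1))
  convert h using 2 with u
  rw [neg_dotProduct]
  rcases le_total 0 (w ⬝ᵥ u) with h | h
  · rw [max_eq_left h, max_eq_right (by linarith)]; ring
  · rw [max_eq_right h, max_eq_left (by linarith)]; ring

theorem coord [DecidableEq ι] (r : ι) (c : ℝ) : IsReluNet 2 (fun u : ι → ℝ => c * u r) := by
  simpa using linear (Pi.single r c)

end IsReluNet

/-- `Ψ` is the correction computed by at most `m` linear attention heads. -/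
def IsAttention {ι : Type} [Fintype ι] {n : ℕ} (m : ℕ)
    (Ψ : Matrix ι (Fin n) ℝ → Matrix ι (Fin n) ℝ) : Prop :=
  ∃ (m' : ℕ) (V G : Fin m' → Matrix ι ι ℝ), m' ≤ m ∧
    ∀ H, Ψ H = ∑ i, (V i * H) * H.transpose * (G i * H)

namespace IsAttention

variable {ι : Type} [Fintype ι] {n m m₁ m₂ : ℕ}
  {Ψ Ψ₁ Ψ₂ : Matrix ι (Fin n) ℝ → Matrix ι (Fin n) ℝ}

theorem add (h₁ : IsAttention m₁ Ψ₁) (h₂ : IsAttention m₂ Ψ₂) :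
    IsAttention (m₁ + m₂) (fun H => Ψ₁ H + Ψ₂ H) := by
  obtain ⟨k₁, V₁, G₁, hm₁, hg₁⟩ := h₁
  obtain ⟨k₂, V₂, G₂, hm₂, hg₂⟩ := h₂
  refine ⟨k₁ + k₂, Fin.append V₁ V₂, Fin.append G₁ G₂, by omega, fun u => ?_⟩
  simp [Fin.sum_univ_add, hg₁, hg₂]

end IsAttention

/-- A layer whose heads realize `Ψ` and whose neurons realize `g`. -/
theorem exists_layer {ι : Type} [Fintype ι] [DecidableEq ι] {n m N : ℕ}
    {Ψ : Matrix ι (Fin n) ℝ → Matrix ι (Fin n) ℝ} {g : ι → (ι → ℝ) → ℝ}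
    (hΨ : IsAttention m Ψ) (hg : ∀ r, IsReluNet N (g r)) :
    ∃ L : TransformerLayer ι, L.heads ≤ m ∧ L.width ≤ Fintype.card ι * (N + 1) ∧
      ∀ H : Matrix ι (Fin n) ℝ,
        L.eval H = Matrix.of fun r j => (H + Ψ H) r j + g r (fun r' => (H + Ψ H) r' j) := by
  obtain ⟨m', V, G, hm', hV⟩ := hΨ
  choose M w c hM hw using hg
  let e : Fin (Fintype.card (Σ r, Fin (M r))) ≃ (Σ r, Fin (M r)) := (Fintype.equivFin _).symm
  refine ⟨⟨m', Fintype.card (Σ r, Fin (M r)), V, fun _ => 1, G,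
    Matrix.of fun k => w (e k).1 (e k).2,
    Matrix.of fun r k => if (e k).1 = r then c (e k).1 (e k).2 else 0⟩, hm', ?_, ?_⟩
  · simp only [TransformerLayer.width]
    refine max_le (by nlinarith) ?_
    rw [Fintype.card_sigma]
    simp only [Fintype.card_fin]
    calc ∑ r, M r ≤ ∑ _r : ι, N := Finset.sum_le_sum fun r _ => hM r
      _ ≤ _ := by simp; gcongr; omega
  · intro H
    have hA : TransformerLayer.attn (⟨m', Fintype.card (Σ r, Fin (M r)), V, fun _ => 1, G,
        Matrix.of fun k => w (e k).1 (e k).2,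
        Matrix.of fun r k => if (e k).1 = r then c (e k).1 (e k).2 else 0⟩ :
        TransformerLayer ι) H = H + Ψ H := by
      simp [TransformerLayer.attn, hV]
    ext r j
    simp only [TransformerLayer.eval, hA, Matrix.add_apply, Matrix.of_apply]
    congr 1
    rw [hw, Matrix.mul_apply]
    refine (Fintype.sum_equiv e _ (fun p : Σ r, Fin (M r) => (if p.1 = r then c p.1 p.2 else 0) *
      max (w p.1 p.2 ⬝ᵥ fun r' => (H + Ψ H) r' j) 0) fun k => rfl).trans ?_
    rw [Fintype.sum_sigma, Finset.sum_eq_single r]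
    · simp
    · intro b _ hb
      simp [hb]
    · simp

/-- Linear combinations of rows of `H`, sent to the rows `f`. -/
def headMap {ι β γ : Type} [Fintype ι] [DecidableEq ι] [Fintype β] [Fintype γ] {n : ℕ}
    (c : ℝ) (f g : β → ι) (k l : γ → ι) (H : Matrix ι (Fin n) ℝ) : Matrix ι (Fin n) ℝ :=
  ((1 : Matrix ι ι ℝ).submatrix f id).transpose *
    (c • (H.submatrix g id * (H.submatrix k id).transpose * H.submatrix l id))

theorem isAttention_headMap {ι β γ : Type} [Fintype ι] [DecidableEq ι] [Fintype β] [Fintype γ]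
    {n : ℕ} (c : ℝ) (f g : β → ι) (k l : γ → ι) :
    IsAttention (n := n) 1 (headMap c f g k l) := by
  refine ⟨1, fun _ => c • (((1 : Matrix ι ι ℝ).submatrix f id).transpose *
    (1 : Matrix ι ι ℝ).submatrix g id), fun _ => ((1 : Matrix ι ι ℝ).submatrix k id).transpose *
    (1 : Matrix ι ι ℝ).submatrix l id, le_rfl, fun H => ?_⟩
  have h : ∀ {δ : Type} (p : δ → ι), (1 : Matrix ι ι ℝ).submatrix p id * H = H.submatrix p id := by
    intro δ p
    ext i j
    simp [Matrix.mul_apply, Matrix.one_apply]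
  have hT : H.transpose * ((1 : Matrix ι ι ℝ).submatrix k id).transpose =
      (H.submatrix k id).transpose := by
    rw [← Matrix.transpose_mul, h]
  simp only [headMap, Finset.univ_unique, Finset.sum_singleton, Matrix.smul_mul, Matrix.mul_smul]
  congr 1
  rw [Matrix.mul_assoc _ _ H, h, Matrix.mul_assoc _ _ H, h, Matrix.mul_assoc _ H.transpose,
    ← Matrix.mul_assoc H.transpose, hT]
  simp only [Matrix.mul_assoc]

/-! ### Transport along a bijection of the token coordinates -/

/-- The layer with token coordinates renamed along `e`. -/
def TransformerLayer.reindex {ι ι' : Type} (e : ι ≃ ι') (L : TransformerLayer ι') :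
    TransformerLayer ι where
  heads := L.heads
  hidden := L.hidden
  WV i := (L.WV i).submatrix e e
  WK i := (L.WK i).submatrix e e
  WQ i := (L.WQ i).submatrix e e
  W1 := L.W1.submatrix id e
  W2 := L.W2.submatrix e id

theorem TransformerLayer.reindex_eval {ι ι' : Type} [Fintype ι] [Fintype ι'] {n : ℕ} (e : ι ≃ ι')
    (L : TransformerLayer ι') (H : Matrix ι' (Fin n) ℝ) :
    (L.reindex e).eval (H.submatrix e id) = (L.eval H).submatrix e id := by
  have hA : (L.reindex e).attn (H.submatrix e id) = (L.attn H).submatrix e id := by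
    simp only [TransformerLayer.attn, reindex, Matrix.submatrix_mul_equiv,
      Matrix.transpose_submatrix]
    ext i j
    simp only [Matrix.add_apply, Matrix.sum_apply, Matrix.submatrix_apply, id]
    congr 1
    refine Finset.sum_congr rfl fun h _ => ?_
    simp only [Matrix.mul_apply, Matrix.submatrix_apply, id]
    rw [← e.sum_comp]
  ext i j
  have hW : (L.reindex e).W1 * (L.attn H).submatrix e id = L.W1 * L.attn H := by
    exact Matrix.submatrix_mul_equiv L.W1 (L.attn H) id e id
  simp only [TransformerLayer.eval, hA, hW]
  rfl

theorem TransformerLayer.reindex_width {ι ι' : Type} [Fintype ι] [Fintype ι'] (e : ι ≃ ι')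
    (L : TransformerLayer ι') : (L.reindex e).width = L.width := by
  simp [TransformerLayer.width, reindex, Fintype.card_congr e]

theorem LinearTransformer.reindex_eval {ι ι' : Type} [Fintype ι] [Fintype ι'] {n : ℕ} (e : ι ≃ ι')
    (T : LinearTransformer ι') (H : Matrix ι' (Fin n) ℝ) :
    LinearTransformer.eval (T.map (TransformerLayer.reindex e)) (H.submatrix e id) =
      (LinearTransformer.eval T H).submatrix e id := by
  induction T generalizing H with
  | nil => rfl
  | cons L T ih =>
    simp only [LinearTransformer.eval, List.map_cons, List.foldl_cons] at ih ⊢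
    rw [TransformerLayer.reindex_eval, ih]

/-! ### ReLU networks multiplying a coordinate by a function of another one -/

theorem IsReluNet.const_mul {ι : Type} [Fintype ι] {N : ℕ} {g : (ι → ℝ) → ℝ}
    (h : IsReluNet N g) (b : ℝ) : IsReluNet N (fun u => b * g u) := by
  obtain ⟨m, w, c, hm, hg⟩ := h
  refine ⟨m, w, fun k => b * c k, hm, fun u => ?_⟩
  simp only [hg, Finset.mul_sum, mul_assoc]

/-- The difference `(relu (a + v) - relu (v - a)) / 2` opens from `0` to `a` as `v` increases. -/
theorem relu_gate (a v : ℝ) : ∃ θ : ℝ, 0 ≤ θ ∧ θ ≤ 1 ∧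
    (max (a + v) 0 - max (-a + v) 0) / 2 = θ * a ∧ (|a| ≤ v → θ = 1) ∧
    (v ≤ -|a| → θ * a = 0) := by
  -- The last clause concerns `θ * a` and not `θ`: when `a = v = 0` both conditions hold, and `θ =
  -- 1` is forced.
  by_cases h1 : |a| ≤ v
  · refine ⟨1, by norm_num, le_rfl, ?_, fun _ => rfl, fun h2 => ?_⟩
    · have := abs_le.1 h1
      rw [max_eq_left (by linarith), max_eq_left (by linarith)]; ring
    · have : |a| = 0 := le_antisymm (by linarith) (abs_nonneg a)
      simp [abs_eq_zero.1 this]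
  by_cases h2 : v ≤ -|a|
  · refine ⟨0, le_rfl, by norm_num, ?_, fun h => absurd h h1, fun _ => by simp⟩
    have := abs_le.1 (show |a| ≤ -v by linarith)
    rw [max_eq_right (by linarith), max_eq_right (by linarith)]; ring
  push Not at h1 h2
  have ha : 0 < |a| := by linarith
  refine ⟨(1 + v / |a|) / 2, ?_, ?_, ?_, fun h => absurd h (by linarith),
    fun h => absurd h (by linarith)⟩
  · have : -1 ≤ v / |a| := by rw [le_div_iff₀ ha]; linarith
    linarith
  · have : v / |a| ≤ 1 := by rw [div_le_iff₀ ha]; linarith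
    linarith
  · rcases lt_or_gt_of_ne (abs_pos.1 ha) with h | h
    · rw [abs_of_neg h] at *
      rw [max_eq_right (by linarith), max_eq_left (by linarith)]
      have := h.ne
      field_simp
      ring
    · rw [abs_of_pos h] at *
      rw [max_eq_left (by linarith), max_eq_right (by linarith)]
      field_simp
      ring

/-- If `φ` varies by at most `τ` at scale `h`, then `(s, a) ↦ φ s * a` is computed with error
`τ |a|` for `s ∈ [l, u]` and `|a| ≤ 1` by about `2 (u - l) / h` neurons. -/
theorem exists_gated_product {φ : ℝ → ℝ} {l u h τ : ℝ} (hh : 0 < h)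
    (hφ : ∀ s s', |s - s'| ≤ h → |φ s - φ s'| ≤ τ) :
    ∃ F : ℝ → ℝ → ℝ → ℝ,
      (∀ {ι : Type} [Fintype ι] [DecidableEq ι] (rs ra ro : ι),
        IsReluNet (2 * (⌊(u - l) / h⌋₊ + 2)) (fun v => F (v rs) (v ra) (v ro))) ∧
      (∀ s o, F s 0 o = 0) ∧ ∀ s a, l ≤ s → s ≤ u → |a| ≤ 1 → |F s a 1 - φ s * a| ≤ τ * |a| := by
  set K := ⌊(u - l) / h⌋₊ + 1 with hK
  -- `c k` is the increment of `φ` over the `k`-th mesh cell. For `o = 1`, `v k` rises linearly from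
  -- `-1` to `1` across that cell, so `|a| ≤ 1` keeps the gate fully open to the right of the cell
  -- and closed to its left. The argument `o` carries the bias.
  let c : ℕ → ℝ := fun k => φ (l + (k + 1 : ℕ) * h) - φ (l + k * h)
  let v : ℕ → ℝ → ℝ → ℝ := fun k s o => 2 / h * s - 2 / h * (l + k * h + h / 2) * o
  refine ⟨fun s a o => φ l * a + ∑ k ∈ Finset.range K,
    (c k / 2 * max (a + v k s o) 0 + -(c k / 2) * max (-a + v k s o) 0), ?_, ?_, ?_⟩
  · intro ι _ _ rs ra ro
    have hsum := IsReluNet.sum (ι := ι) (K := K) (N := 2) (f := fun k w =>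
      c k / 2 * max (w ra + v k (w rs) (w ro)) 0 + -(c k / 2) * max (-w ra + v k (w rs) (w ro)) 0)
      (fun k => by
        have h1 := (IsReluNet.relu (Pi.single ra 1 + Pi.single rs (2 / h) -
          Pi.single ro (2 / h * (l + k * h + h / 2))) (c k / 2)).add
          (IsReluNet.relu (Pi.single ra (-1) + Pi.single rs (2 / h) -
          Pi.single ro (2 / h * (l + k * h + h / 2))) (-(c k / 2)))
        convert h1 using 6 with w <;> simp [v] <;> ring)
    exact ((IsReluNet.coord ra (φ l)).add hsum).mono (by omega)
  · intro s o
    simp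
  · intro s a hls hsu ha
    dsimp only
    set j := ⌊(s - l) / h⌋₊ with hj
    have hj0 : 0 ≤ (s - l) / h := div_nonneg (by linarith) hh.le
    have hj1 : (j : ℝ) * h ≤ s - l := by
      rw [← le_div_iff₀ hh]; exact Nat.floor_le hj0
    have hj2 : s - l < (j + 1) * h := by
      rw [← div_lt_iff₀ hh]; exact Nat.lt_floor_add_one _
    have hjK : j < K := by
      have : j ≤ ⌊(u - l) / h⌋₊ := Nat.floor_le_floor (by gcongr)
      omega
    have hv : ∀ k, v k s 1 = 2 / h * (s - l - k * h - h / 2) := fun k => by simp only [v]; ring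
    have hterm : ∀ k, c k / 2 * max (a + v k s 1) 0 + -(c k / 2) * max (-a + v k s 1) 0 =
        c k * ((max (a + v k s 1) 0 - max (-a + v k s 1) 0) / 2) := fun k => by ring
    choose θ h0 h1 hθ hone hzero using fun k => relu_gate a (v k s 1)
    simp only [hterm, hθ]
    have hlow : ∀ k < j, θ k = 1 := by
      intro k hk
      refine hone k (ha.trans ?_)
      have hk' : (k : ℝ) + 1 ≤ j := by exact_mod_cast hk
      rw [hv, div_mul_eq_mul_div, le_div_iff₀ hh]
      nlinarith
    have hhigh : ∀ k, j < k → θ k * a = 0 := by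
      intro k hk
      refine hzero k ?_
      have hk' : (j : ℝ) + 1 ≤ k := by exact_mod_cast hk
      have : v k s 1 ≤ -1 := by
        rw [hv, div_mul_eq_mul_div, div_le_iff₀ hh]
        nlinarith
      linarith
    obtain ⟨r, hr⟩ : ∃ r, K = j + 1 + r := ⟨K - (j + 1), by omega⟩
    have hsum : ∑ k ∈ Finset.range K, c k * (θ k * a) =
        (φ (l + j * h) - φ l) * a + c j * (θ j * a) := by
      rw [hr, Finset.sum_range_add, Finset.sum_range_succ]
      rw [Finset.sum_eq_zero (s := Finset.range r) fun k _ => by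
        rw [hhigh _ (by omega), mul_zero]]
      rw [Finset.sum_congr rfl fun k hk => by
        rw [hlow k (Finset.mem_range.1 hk), one_mul], ← Finset.sum_mul,
        Finset.sum_range_sub (fun k : ℕ => φ (l + k * h))]
      simp
    rw [hsum]
    have e1 : |φ (l + j * h) - φ s| ≤ τ := hφ _ _ (by rw [abs_le]; constructor <;> linarith)
    have e2 : |φ (l + (j + 1 : ℕ) * h) - φ s| ≤ τ :=
      hφ _ _ (by push_cast; rw [abs_le]; constructor <;> linarith)
    -- After telescoping, only the gate of the cell containing `s` is undecided. The output is `a`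
    -- times a convex combination of `φ` at the two ends of that cell.
    have : φ l * a + ((φ (l + j * h) - φ l) * a + c j * (θ j * a)) - φ s * a =
        ((1 - θ j) * (φ (l + j * h) - φ s) + θ j * (φ (l + (j + 1 : ℕ) * h) - φ s)) * a := by
      simp only [c]; ring
    rw [this, abs_mul]
    gcongr
    calc _ ≤ |(1 - θ j) * (φ (l + j * h) - φ s)| + |θ j * (φ (l + (j + 1 : ℕ) * h) - φ s)| :=
          abs_add_le _ _
      _ = (1 - θ j) * |φ (l + j * h) - φ s| + θ j * |φ (l + (j + 1 : ℕ) * h) - φ s| := by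
          rw [abs_mul, abs_mul, abs_of_nonneg (h0 j), abs_of_nonneg (by linarith [h1 j] : 0 ≤ 1 - θ j)]
      _ ≤ (1 - θ j) * τ + θ j * τ := by
          have := h0 j
          have := h1 j
          gcongr
      _ = τ := by ring

/-! ### Token matrices in block form -/

/-- The token coordinates: seven blocks of `d` rows and five single rows. -/
abbrev BlockRow (d : ℕ) : Type := (Fin 7 × Fin d) ⊕ Fin 5

/-- The rows of a block. -/
def blk {d : ℕ} (b : Fin 7) : Fin d → BlockRow d := fun i => .inl (b, i)

@[simp] theorem blk_apply {d : ℕ} (b : Fin 7) (i : Fin d) : blk b i = .inl (b, i) := rfl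

/-- A single row. -/
def row {d : ℕ} (r : BlockRow d) : Unit → BlockRow d := fun _ => r

section Blocks

variable {d n : ℕ}

/-- The token matrix with the blocks `X₀, …, X₆` and the single rows `s₀, …, s₄`. -/
def tokens (X₀ X₁ X₂ X₃ X₄ X₅ X₆ : Matrix (Fin d) (Fin n) ℝ) (s₀ s₁ s₂ s₃ s₄ : Fin n → ℝ) :
    Matrix (BlockRow d) (Fin n) ℝ
  | .inl (0, i), j => X₀ i j
  | .inl (1, i), j => X₁ i j
  | .inl (2, i), j => X₂ i j
  | .inl (3, i), j => X₃ i j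
  | .inl (4, i), j => X₄ i j
  | .inl (5, i), j => X₅ i j
  | .inl (6, i), j => X₆ i j
  | .inr 0, j => s₀ j
  | .inr 1, j => s₁ j
  | .inr 2, j => s₂ j
  | .inr 3, j => s₃ j
  | .inr 4, j => s₄ j

section Tokens

variable (X₀ X₁ X₂ X₃ X₄ X₅ X₆ : Matrix (Fin d) (Fin n) ℝ) (s₀ s₁ s₂ s₃ s₄ : Fin n → ℝ)

@[simp] theorem tokens_blk0 : (tokens X₀ X₁ X₂ X₃ X₄ X₅ X₆ s₀ s₁ s₂ s₃ s₄).submatrix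
    (blk 0) id = X₀ := rfl

@[simp] theorem tokens_inl0 (i : Fin d) (j : Fin n) :
    tokens X₀ X₁ X₂ X₃ X₄ X₅ X₆ s₀ s₁ s₂ s₃ s₄ (.inl (0, i)) j = X₀ i j := rfl

@[simp] theorem tokens_blk1 : (tokens X₀ X₁ X₂ X₃ X₄ X₅ X₆ s₀ s₁ s₂ s₃ s₄).submatrix
    (blk 1) id = X₁ := rfl

@[simp] theorem tokens_inl1 (i : Fin d) (j : Fin n) :
    tokens X₀ X₁ X₂ X₃ X₄ X₅ X₆ s₀ s₁ s₂ s₃ s₄ (.inl (1, i)) j = X₁ i j := rfl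

@[simp] theorem tokens_blk2 : (tokens X₀ X₁ X₂ X₃ X₄ X₅ X₆ s₀ s₁ s₂ s₃ s₄).submatrix
    (blk 2) id = X₂ := rfl

@[simp] theorem tokens_inl2 (i : Fin d) (j : Fin n) :
    tokens X₀ X₁ X₂ X₃ X₄ X₅ X₆ s₀ s₁ s₂ s₃ s₄ (.inl (2, i)) j = X₂ i j := rfl

@[simp] theorem tokens_blk3 : (tokens X₀ X₁ X₂ X₃ X₄ X₅ X₆ s₀ s₁ s₂ s₃ s₄).submatrix
    (blk 3) id = X₃ := rfl

@[simp] theorem tokens_inl3 (i : Fin d) (j : Fin n) :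
    tokens X₀ X₁ X₂ X₃ X₄ X₅ X₆ s₀ s₁ s₂ s₃ s₄ (.inl (3, i)) j = X₃ i j := rfl

@[simp] theorem tokens_blk4 : (tokens X₀ X₁ X₂ X₃ X₄ X₅ X₆ s₀ s₁ s₂ s₃ s₄).submatrix
    (blk 4) id = X₄ := rfl

@[simp] theorem tokens_inl4 (i : Fin d) (j : Fin n) :
    tokens X₀ X₁ X₂ X₃ X₄ X₅ X₆ s₀ s₁ s₂ s₃ s₄ (.inl (4, i)) j = X₄ i j := rfl

@[simp] theorem tokens_blk5 : (tokens X₀ X₁ X₂ X₃ X₄ X₅ X₆ s₀ s₁ s₂ s₃ s₄).submatrix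
    (blk 5) id = X₅ := rfl

@[simp] theorem tokens_inl5 (i : Fin d) (j : Fin n) :
    tokens X₀ X₁ X₂ X₃ X₄ X₅ X₆ s₀ s₁ s₂ s₃ s₄ (.inl (5, i)) j = X₅ i j := rfl

@[simp] theorem tokens_blk6 : (tokens X₀ X₁ X₂ X₃ X₄ X₅ X₆ s₀ s₁ s₂ s₃ s₄).submatrix
    (blk 6) id = X₆ := rfl

@[simp] theorem tokens_inl6 (i : Fin d) (j : Fin n) :
    tokens X₀ X₁ X₂ X₃ X₄ X₅ X₆ s₀ s₁ s₂ s₃ s₄ (.inl (6, i)) j = X₆ i j := rfl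

@[simp] theorem tokens_inr0 (j : Fin n) :
    tokens X₀ X₁ X₂ X₃ X₄ X₅ X₆ s₀ s₁ s₂ s₃ s₄ (.inr 0) j = s₀ j := rfl

@[simp] theorem tokens_inr1 (j : Fin n) :
    tokens X₀ X₁ X₂ X₃ X₄ X₅ X₆ s₀ s₁ s₂ s₃ s₄ (.inr 1) j = s₁ j := rfl

@[simp] theorem tokens_inr2 (j : Fin n) :
    tokens X₀ X₁ X₂ X₃ X₄ X₅ X₆ s₀ s₁ s₂ s₃ s₄ (.inr 2) j = s₂ j := rfl

@[simp] theorem tokens_inr3 (j : Fin n) :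
    tokens X₀ X₁ X₂ X₃ X₄ X₅ X₆ s₀ s₁ s₂ s₃ s₄ (.inr 3) j = s₃ j := rfl

@[simp] theorem tokens_inr4 (j : Fin n) :
    tokens X₀ X₁ X₂ X₃ X₄ X₅ X₆ s₀ s₁ s₂ s₃ s₄ (.inr 4) j = s₄ j := rfl

variable {X₀ X₁ X₂ X₃ X₄ X₅ X₆ s₀ s₁ s₂ s₃ s₄}

theorem eq_tokens {H : Matrix (BlockRow d) (Fin n) ℝ}
    (h0 : ∀ i j, H (.inl (0, i)) j = X₀ i j)
    (h1 : ∀ i j, H (.inl (1, i)) j = X₁ i j)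
    (h2 : ∀ i j, H (.inl (2, i)) j = X₂ i j)
    (h3 : ∀ i j, H (.inl (3, i)) j = X₃ i j)
    (h4 : ∀ i j, H (.inl (4, i)) j = X₄ i j)
    (h5 : ∀ i j, H (.inl (5, i)) j = X₅ i j)
    (h6 : ∀ i j, H (.inl (6, i)) j = X₆ i j)
    (k0 : ∀ j, H (.inr 0) j = s₀ j)
    (k1 : ∀ j, H (.inr 1) j = s₁ j)
    (k2 : ∀ j, H (.inr 2) j = s₂ j)
    (k3 : ∀ j, H (.inr 3) j = s₃ j)
    (k4 : ∀ j, H (.inr 4) j = s₄ j) :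
    H = tokens X₀ X₁ X₂ X₃ X₄ X₅ X₆ s₀ s₁ s₂ s₃ s₄ := by
  ext (⟨b, i⟩ | t) j
  · fin_cases b
    · exact h0 i j
    · exact h1 i j
    · exact h2 i j
    · exact h3 i j
    · exact h4 i j
    · exact h5 i j
    · exact h6 i j
  · fin_cases t
    · exact k0 j
    · exact k1 j
    · exact k2 j
    · exact k3 j
    · exact k4 j

end Tokens

theorem headMap_blk_inl {γ : Type} [Fintype γ] (c : ℝ) (p q : Fin 7) (k l : γ → BlockRow d)
    (H : Matrix (BlockRow d) (Fin n) ℝ) (b : Fin 7) (i : Fin d) (j : Fin n) :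
    headMap c (blk p) (blk q) k l H (.inl (b, i)) j = if b = p then
      c * (H.submatrix (blk q) id * (H.submatrix k id).transpose * H.submatrix l id) i j else 0 := by
  split_ifs with h
  · subst h
    rw [headMap, Matrix.mul_apply, Finset.sum_eq_single i]
    · simp [blk, Matrix.one_apply]
    · intro i' _ hi
      simp [blk, hi, Matrix.one_apply]
    · simp
  · rw [headMap, Matrix.mul_apply]
    refine Finset.sum_eq_zero fun i' _ => ?_
    simp [blk, Matrix.one_apply, Ne.symm h]

@[simp] theorem headMap_blk_inr {γ : Type} [Fintype γ] (c : ℝ) (p q : Fin 7) (k l : γ → BlockRow d)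
    (H : Matrix (BlockRow d) (Fin n) ℝ) (t : Fin 5) (j : Fin n) :
    headMap c (blk p) (blk q) k l H (.inr t) j = 0 := by
  rw [headMap, Matrix.mul_apply]
  exact Finset.sum_eq_zero fun i' _ => by simp [blk, Matrix.one_apply]

@[simp] theorem headMap_row_inl {γ : Type} [Fintype γ] (c : ℝ) (p : Fin 5) (q : BlockRow d)
    (k l : γ → BlockRow d) (H : Matrix (BlockRow d) (Fin n) ℝ) (b : Fin 7 × Fin d) (j : Fin n) :
    headMap c (row (.inr p)) (row q) k l H (.inl b) j = 0 := by
  rw [headMap, Matrix.mul_apply]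
  exact Finset.sum_eq_zero fun i' _ => by simp [row, Matrix.one_apply]

theorem headMap_row_inr {γ : Type} [Fintype γ] (c : ℝ) (p : Fin 5) (q : BlockRow d)
    (k l : γ → BlockRow d) (H : Matrix (BlockRow d) (Fin n) ℝ) (t : Fin 5) (j : Fin n) :
    headMap c (row (.inr p)) (row q) k l H (.inr t) j = if t = p then
      c * (H.submatrix (row q) id * (H.submatrix k id).transpose * H.submatrix l id) () j else 0 := by
  rw [headMap, Matrix.mul_apply]
  by_cases h : t = p
  · subst h; simp [row, Matrix.one_apply]
  · simp [row, h, Matrix.one_apply, Ne.symm h]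

@[simp] theorem headMap_blk_blk_inl (c : ℝ) (p q k l : Fin 7)
    (H : Matrix (BlockRow d) (Fin n) ℝ) (b : Fin 7) (i : Fin d) (j : Fin n) :
    headMap c (blk p) (blk q) (blk k) (blk l) H (.inl (b, i)) j = if b = p then
      c * (H.submatrix (blk q) id * (H.submatrix (blk k) id).transpose *
        H.submatrix (blk l) id) i j else 0 :=
  headMap_blk_inl c p q _ _ H b i j

@[simp] theorem headMap_blk_row_inl (c : ℝ) (p q : Fin 7) (k l : BlockRow d)
    (H : Matrix (BlockRow d) (Fin n) ℝ) (b : Fin 7) (i : Fin d) (j : Fin n) :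
    headMap c (blk p) (blk q) (row k) (row l) H (.inl (b, i)) j = if b = p then
      c * ((∑ t, H (.inl (q, i)) t * H k t) * H l j) else 0 := by
  simp [headMap_blk_inl, Matrix.mul_apply, blk, row]

@[simp] theorem headMap_row_row_inr (c : ℝ) (p : Fin 5) (q k l : BlockRow d)
    (H : Matrix (BlockRow d) (Fin n) ℝ) (t : Fin 5) (j : Fin n) :
    headMap c (row (.inr p)) (row q) (row k) (row l) H (.inr t) j = if t = p then
      c * ((∑ t, H q t * H k t) * H l j) else 0 := by
  simp [headMap_row_inr, Matrix.mul_apply, row]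

@[simp] theorem headMap_row_blk_inr (c : ℝ) (p : Fin 5) (q : BlockRow d) (k l : Fin 7)
    (H : Matrix (BlockRow d) (Fin n) ℝ) (t : Fin 5) (j : Fin n) :
    headMap c (row (.inr p)) (row q) (blk k) (blk l) H (.inr t) j = if t = p then
      c * ∑ i, (∑ t, H q t * H.submatrix (blk k) id i t) * H.submatrix (blk l) id i j else 0 := by
  simp [headMap_row_inr, Matrix.mul_apply, row]

variable (d n) in
/-- The block `[I_d 0]`. -/
def eyeBlock : Matrix (Fin d) (Fin n) ℝ := Matrix.of fun i j => if (i : ℕ) = (j : ℕ) then 1 else 0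

variable (n) in
/-- The block `v 1ₙᵀ`. -/
def constBlock (v : Fin d → ℝ) : Matrix (Fin d) (Fin n) ℝ := Matrix.of fun i _ => v i

variable (n) in
/-- The row `e₁ᵀ / n`. -/
noncomputable def firstRow : Fin n → ℝ := fun j => if (j : ℕ) = 0 then 1 / (n : ℝ) else 0

theorem eyeBlock_mul_transpose (h : d ≤ n) :
    eyeBlock d n * (eyeBlock d n).transpose = 1 := by
  ext i j
  rw [Matrix.mul_apply, Finset.sum_eq_single ⟨i, by omega⟩]
  · simp [eyeBlock, Matrix.one_apply, Fin.ext_iff, eq_comm]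
  · intro b _ hb
    have : (i : ℕ) ≠ b := fun h => hb (by ext; simp [h])
    simp [eyeBlock, this]
  · simp

/-- This makes one linear attention head a multiplication of `d × d` matrices: with `J = [I_d 0]`,
the inner factor `J Jᵀ` disappears. -/
theorem mul_eyeBlock_mul (h : d ≤ n) {m : ℕ} (X : Matrix (Fin d) (Fin d) ℝ)
    (Y : Matrix (Fin d) (Fin d) ℝ) (Z : Matrix (Fin d) (Fin m) ℝ) :
    X * eyeBlock d n * (Y * eyeBlock d n).transpose * Z = X * Y.transpose * Z := by
  rw [Matrix.transpose_mul, Matrix.mul_assoc X, ← Matrix.mul_assoc (eyeBlock d n),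
    eyeBlock_mul_transpose h, Matrix.one_mul]

theorem mul_constBlock (X : Matrix (Fin d) (Fin d) ℝ) (v : Fin d → ℝ) :
    X * constBlock n v = constBlock n (X.mulVec v) := by
  ext i j
  simp [constBlock, Matrix.mul_apply, Matrix.mulVec, dotProduct]

/-- Contracting with `e₁ᵀ / n` reads a block `v 1ₙᵀ` in a single column. A head of weight `n` then
yields scalar products with `v`. -/
theorem firstRow_sum (hn : 0 < n) (f : Fin n → ℝ) :
    ∑ j, firstRow n j * f j = 1 / n * f ⟨0, hn⟩ := by
  rw [Finset.sum_eq_single ⟨0, hn⟩]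
  · simp [firstRow]
  · intro b _ hb
    have : (b : ℕ) ≠ 0 := fun h => hb (by ext; simp [h])
    simp [firstRow, this]
  · simp

end Blocks

/-! ### The individual layers -/

section Layers

variable {d n N : ℕ}

/-- The layer that does nothing. -/
theorem exists_identity_layer (ι : Type) [Fintype ι] (n : ℕ) :
    ∃ L : TransformerLayer ι, L.heads ≤ 0 ∧ L.width ≤ Fintype.card ι ∧
      ∀ H : Matrix ι (Fin n) ℝ, L.eval H = H := by
  refine ⟨⟨0, 0, fun _ => 0, fun _ => 0, fun _ => 0, 0, 0⟩, le_rfl, ?_, fun H => ?_⟩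
  · simp [TransformerLayer.width]
  · simp [TransformerLayer.eval, TransformerLayer.attn]

/-- The margins `⟨x, aⱼ⟩` are computed, and two functions of them are multiplied into `aⱼ`. -/
theorem exists_margin_layer (hn : 0 < n) (hN : 2 ≤ N) {F₁ F₂ : ℝ → ℝ → ℝ → ℝ}
    (h₁ : ∀ rs ra ro : BlockRow d, IsReluNet N (fun v => F₁ (v rs) (v ra) (v ro)))
    (h₂ : ∀ rs ra ro : BlockRow d, IsReluNet N (fun v => F₂ (v rs) (v ra) (v ro))) :
    ∃ L : TransformerLayer (BlockRow d), L.heads ≤ 8 ∧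
      L.width ≤ Fintype.card (BlockRow d) * (N + 5) ∧
      ∀ (A : Matrix (Fin d) (Fin n) ℝ) (y : Fin n → ℝ) (x : Fin d → ℝ),
        L.eval (tokens (eyeBlock d n) (eyeBlock d n) (eyeBlock d n) 0 0 A (constBlock n x)
          0 y (firstRow n) 0 1) =
        tokens (eyeBlock d n) (eyeBlock d n) (eyeBlock d n)
          (Matrix.of fun i j => F₁ (A.transpose.mulVec x j) (A i j) 1)
          (Matrix.of fun i j => F₂ (A.transpose.mulVec x j) (A i j) 1) A (constBlock n x)
          (A.transpose.mulVec x) y (firstRow n) 0 1 := by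
  obtain ⟨L, hL₁, hL₂, hL⟩ := exists_layer (n := n) (N := N + 4)
    (isAttention_headMap (n : ℝ) (row (.inr 0)) (row (.inr 2))
      (blk (d := d) 6) (blk 5))
    (g := fun r u => match r with
      | .inl (3, i) => F₁ (u (.inr 0)) (u (.inl (5, i))) (u (.inr 4))
      | .inl (4, i) => F₂ (u (.inr 0)) (u (.inl (5, i))) (u (.inr 4))
      | _ => 0) (by
      intro r
      split
      exacts [(h₁ _ _ _).mono (by omega), (h₂ _ _ _).mono (by omega),
        IsReluNet.zero.mono (by omega)])
  refine ⟨L, by omega, hL₂, fun A y x => ?_⟩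
  rw [hL]
  have hs : ∀ j, (n : ℝ) * ∑ i, (∑ t, firstRow n t * constBlock n x i t) * A i j =
      A.transpose.mulVec x j := by
    intro j
    have : (n : ℝ) ≠ 0 := by positivity
    simp only [firstRow_sum hn, Finset.mul_sum, Matrix.mulVec, dotProduct, constBlock,
      Matrix.of_apply, Matrix.transpose_apply]
    refine Finset.sum_congr rfl fun i _ => ?_
    field_simp
  refine eq_tokens ?_ ?_ ?_ ?_ ?_ ?_ ?_ ?_ ?_ ?_ ?_ ?_ <;> intros <;> simp [hs]

/-- The symmetrized weighted covariance, the gradient and the scale of `∇²f` are computed. -/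
theorem exists_gradient_layer (hd : 0 < d) (hdn : d ≤ n) (hN : 2 ≤ N) (μ : ℝ)
    {F : ℝ → ℝ → ℝ → ℝ} (hF0 : ∀ s, F s 0 1 = 0)
    (hF : ∀ rs ra ro : BlockRow d, IsReluNet N (fun v => F (v rs) (v ra) (v ro))) :
    ∃ L : TransformerLayer (BlockRow d), L.heads ≤ 8 ∧
      L.width ≤ Fintype.card (BlockRow d) * (N + 5) ∧
      ∀ (A B P : Matrix (Fin d) (Fin n) ℝ) (s y : Fin n → ℝ) (x : Fin d → ℝ),
        L.eval (tokens (eyeBlock d n) (eyeBlock d n) (eyeBlock d n) B P A (constBlock n x)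
          s y (firstRow n) 0 1) =
        tokens (eyeBlock d n)
          ((μ • (1 : Matrix (Fin d) (Fin d) ℝ) + (1 / (2 * n) : ℝ) •
            (B * A.transpose + A * B.transpose)) * eyeBlock d n)
          (constBlock n fun i => μ * x i + 1 / n * ∑ j, (P i j - (1 + y j) / 2 * A i j))
          (F (1 / n * ∑ j, B ⟨0, hd⟩ j * A ⟨0, hd⟩ j) 1 1 • eyeBlock d n) 0 A
          (constBlock n x)
          0 y (firstRow n) 0 1 := by
  have hn : 0 < n := by omega
  -- Block 1 already holds `[I_d 0]`, so weight `μ - 1` suffices to create `μ`. Sums over tokens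
  -- come from pairing with the row of ones, and pairing with the label row gives the term in `y`.
  -- The last head forms the data part of the first diagonal entry of the Hessian approximation. The
  -- neurons with coefficient `-1` erase what is no longer needed.
  obtain ⟨L, hL₁, hL₂, hL⟩ := exists_layer (n := n) (N := N + 4)
    ((((((((isAttention_headMap (1 / (2 * n) : ℝ) (blk (d := d) 1) (blk 3) (blk (d := d) 5)
        (blk 0)).add
      (isAttention_headMap (1 / (2 * n) : ℝ) (blk 1) (blk 5) (blk (d := d) 3) (blk 0))).add
      (isAttention_headMap (μ - 1) (blk 1) (blk 0) (blk (d := d) 0) (blk 0))).add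
      (isAttention_headMap (μ / n) (blk 2) (blk 6) (row (d := d) (.inr 4)) (row (.inr 4)))).add
      (isAttention_headMap (1 / n) (blk 2) (blk 4) (row (d := d) (.inr 4)) (row (.inr 4)))).add
      (isAttention_headMap (-1 / (2 * n)) (blk 2) (blk 5) (row (d := d) (.inr 4))
        (row (.inr 4)))).add
      (isAttention_headMap (-1 / (2 * n)) (blk 2) (blk 5) (row (d := d) (.inr 1))
        (row (.inr 4)))).add
      (isAttention_headMap (1 / n) (row (d := d) (.inr 3)) (row (.inl (3, ⟨0, hd⟩)))
        (row (d := d) (.inl (5, ⟨0, hd⟩))) (row (.inr 4))))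
    (g := fun r u => match r with
      | .inl (2, i) => -1 * u (.inl (0, i))
      | .inl (3, i) => -1 * u (.inl (3, i)) + F (u (.inr 3)) (u (.inl (0, i))) (u (.inr 4))
      | .inl (4, i) => -1 * u (.inl (4, i))
      | .inr 0 => -1 * u (.inr 0)
      | .inr 3 => -1 * u (.inr 3)
      | _ => 0) (by
      intro r
      split
      exacts [(IsReluNet.coord _ _).mono (by omega),
        ((IsReluNet.coord _ _).add (hF _ _ _)).mono (by omega),
        (IsReluNet.coord _ _).mono (by omega), (IsReluNet.coord _ _).mono (by omega),
        (IsReluNet.coord _ _).mono (by omega), IsReluNet.zero.mono (by omega)])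
  refine ⟨L, by omega, hL₂, fun A B P s y x => ?_⟩
  rw [hL]
  have hJ := eyeBlock_mul_transpose hdn
  have hn' : (n : ℝ) ≠ 0 := by positivity
  -- Because `F` vanishes when its second argument is `0`, applying it to the entries of `[I_d 0]`
  -- gives an exact scalar multiple of that block.
  have hF1 : ∀ t i j, F t (eyeBlock d n i j) 1 = F t 1 1 * eyeBlock d n i j := by
    intro t i j
    simp only [eyeBlock, Matrix.of_apply]
    split_ifs <;> simp [hF0]
  have he : ∀ i, ∑ j, (P i j - (1 + y j) / 2 * A i j) =
      ∑ j, P i j - 1 / 2 * ∑ j, A i j - 1 / 2 * ∑ j, A i j * y j := by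
    intro i
    rw [Finset.mul_sum, Finset.mul_sum, ← Finset.sum_sub_distrib, ← Finset.sum_sub_distrib]
    exact Finset.sum_congr rfl fun j _ => by ring
  refine eq_tokens ?_ ?_ ?_ ?_ ?_ ?_ ?_ ?_ ?_ ?_ ?_ ?_ <;> intros <;>
    simp [-Matrix.transpose_mul, -Finset.sum_sub_distrib, he, hF1, hJ, Matrix.add_mul]
  · ring
  · simp [constBlock]
    field_simp
    ring

/-- The initial residual `1 - α M` is computed. -/
theorem exists_residual_layer (hdn : d ≤ n) :
    ∃ L : TransformerLayer (BlockRow d), L.heads ≤ 8 ∧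
      L.width ≤ Fintype.card (BlockRow d) * 5 ∧
      ∀ (M : Matrix (Fin d) (Fin d) ℝ) (α : ℝ) (G A x : Matrix (Fin d) (Fin n) ℝ)
        (s₀ s₁ s₂ s₃ s₄ : Fin n → ℝ),
        L.eval (tokens (eyeBlock d n) (M * eyeBlock d n) G (α • eyeBlock d n) 0 A x
          s₀ s₁ s₂ s₃ s₄) =
        tokens (eyeBlock d n) (M * eyeBlock d n) G
          ((α • (1 : Matrix (Fin d) (Fin d) ℝ)) * eyeBlock d n)
          ((1 - α • M.transpose) * eyeBlock d n) A x
          s₀ s₁ s₂ s₃ s₄ := by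
  obtain ⟨L, hL₁, hL₂, hL⟩ := exists_layer (n := n) (N := 4)
    ((isAttention_headMap 1 (blk (d := d) 4) (blk 0) (blk (d := d) 0) (blk 0)).add
      (isAttention_headMap (-1) (blk 4) (blk 3) (blk (d := d) 1) (blk 0)))
    (g := fun _ _ => 0) (fun _ => IsReluNet.zero.mono (by omega))
  refine ⟨L, by omega, hL₂, fun M α G A x s₀ s₁ s₂ s₃ s₄ => ?_⟩
  rw [hL]
  have hJ := eyeBlock_mul_transpose hdn
  have h := mul_eyeBlock_mul hdn 1 M (eyeBlock d n)
  rw [Matrix.one_mul, Matrix.one_mul] at h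
  refine eq_tokens ?_ ?_ ?_ ?_ ?_ ?_ ?_ ?_ ?_ ?_ ?_ ?_ <;> intros <;>
    simp [-Matrix.transpose_mul, hJ, h, Matrix.sub_mul]
  ring

/-- One step of the iteration `X ↦ X + X Rᵀ`, `R ↦ R Rᵀ`. -/
theorem exists_squaring_layer (hdn : d ≤ n) :
    ∃ L : TransformerLayer (BlockRow d), L.heads ≤ 8 ∧
      L.width ≤ Fintype.card (BlockRow d) * 5 ∧
      ∀ (X R : Matrix (Fin d) (Fin d) ℝ) (M G A x : Matrix (Fin d) (Fin n) ℝ)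
        (s₀ s₁ s₂ s₃ s₄ : Fin n → ℝ),
        L.eval (tokens (eyeBlock d n) M G (X * eyeBlock d n) (R * eyeBlock d n) A x
          s₀ s₁ s₂ s₃ s₄) =
        tokens (eyeBlock d n) M G ((X + X * R.transpose) * eyeBlock d n)
          ((R * R.transpose) * eyeBlock d n) A x
          s₀ s₁ s₂ s₃ s₄ := by
  obtain ⟨L, hL₁, hL₂, hL⟩ := exists_layer (n := n) (N := 4)
    (((isAttention_headMap 1 (blk (d := d) 3) (blk 3) (blk (d := d) 4) (blk 0)).add
      (isAttention_headMap 1 (blk 4) (blk 4) (blk (d := d) 4) (blk 0))).add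
      (isAttention_headMap (-1) (blk 4) (blk 4) (blk (d := d) 0) (blk 0)))
    (g := fun _ _ => 0) (fun _ => IsReluNet.zero.mono (by omega))
  refine ⟨L, by omega, hL₂, fun X R M G A x s₀ s₁ s₂ s₃ s₄ => ?_⟩
  rw [hL]
  -- The third head subtracts the old `R`, which the residual connection would otherwise leave in
  -- block 4.
  have h1 := mul_eyeBlock_mul hdn X R (eyeBlock d n)
  have h2 := mul_eyeBlock_mul hdn R R (eyeBlock d n)
  have h3 : R * eyeBlock d n * (eyeBlock d n).transpose * eyeBlock d n = R * eyeBlock d n := by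
    rw [Matrix.mul_assoc R, eyeBlock_mul_transpose hdn, Matrix.mul_one]
  refine eq_tokens ?_ ?_ ?_ ?_ ?_ ?_ ?_ ?_ ?_ ?_ ?_ ?_ <;> intros <;> simp [-Matrix.transpose_mul, h1, h2, h3, Matrix.add_mul]

/-- The direction `X g` is computed. -/
theorem exists_direction_layer (hdn : d ≤ n) :
    ∃ L : TransformerLayer (BlockRow d), L.heads ≤ 8 ∧
      L.width ≤ Fintype.card (BlockRow d) * 5 ∧
      ∀ (M X : Matrix (Fin d) (Fin d) ℝ) (g : Fin d → ℝ) (R A x : Matrix (Fin d) (Fin n) ℝ)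
        (s₀ s₁ s₂ s₃ s₄ : Fin n → ℝ),
        L.eval (tokens (eyeBlock d n) (M * eyeBlock d n) (constBlock n g) (X * eyeBlock d n) R A x
          s₀ s₁ s₂ s₃ s₄) =
        tokens (eyeBlock d n) (constBlock n (X.mulVec g)) (constBlock n g) (X * eyeBlock d n) R A x
          s₀ s₁ s₂ s₃ s₄ := by
  obtain ⟨L, hL₁, hL₂, hL⟩ := exists_layer (n := n) (N := 4)
    ((isAttention_headMap 1 (blk (d := d) 1) (blk 3) (blk (d := d) 0) (blk 2)).add
      (isAttention_headMap (-1) (blk 1) (blk 1) (blk (d := d) 0) (blk 0)))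
    (g := fun _ _ => 0) (fun _ => IsReluNet.zero.mono (by omega))
  refine ⟨L, by omega, hL₂, fun M X g R A x s₀ s₁ s₂ s₃ s₄ => ?_⟩
  rw [hL]
  have h1 : X * eyeBlock d n * (eyeBlock d n).transpose * constBlock n g =
      constBlock n (X.mulVec g) := by
    rw [Matrix.mul_assoc X, eyeBlock_mul_transpose hdn, Matrix.mul_one, mul_constBlock]
  have h2 : M * eyeBlock d n * (eyeBlock d n).transpose * eyeBlock d n = M * eyeBlock d n := by
    rw [Matrix.mul_assoc M, eyeBlock_mul_transpose hdn, Matrix.mul_one]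
  refine eq_tokens ?_ ?_ ?_ ?_ ?_ ?_ ?_ ?_ ?_ ?_ ?_ ?_ <;> intros <;> simp [h1, h2]

/-- A function of the scalar product `g ⬝ᵥ v` is computed. -/
theorem exists_decrement_layer (hn : 0 < n) {F : ℝ → ℝ → ℝ → ℝ}
    (hF : ∀ rs ra ro : BlockRow d, IsReluNet N (fun v => F (v rs) (v ra) (v ro))) :
    ∃ L : TransformerLayer (BlockRow d), L.heads ≤ 8 ∧
      L.width ≤ Fintype.card (BlockRow d) * (N + 5) ∧
      ∀ (v g : Fin d → ℝ) (y : Fin n → ℝ) (J X R A x : Matrix (Fin d) (Fin n) ℝ),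
        L.eval (tokens J (constBlock n v) (constBlock n g) X R A x
          0 y (firstRow n) 0 1) =
        tokens J (constBlock n v) (constBlock n g) X R A x
          (fun _ => F (g ⬝ᵥ v) 1 1) y (firstRow n) (fun _ => g ⬝ᵥ v) 1 := by
  obtain ⟨L, hL₁, hL₂, hL⟩ := exists_layer (n := n) (N := N + 4)
    (isAttention_headMap (n : ℝ) (row (.inr 3)) (row (.inr 2))
      (blk (d := d) 2) (blk 1))
    (g := fun r u => match r with
      | .inr 0 => F (u (.inr 3)) (u (.inr 4)) (u (.inr 4))
      | _ => 0) (by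
      intro r
      split
      exacts [(hF _ _ _).mono (by omega), IsReluNet.zero.mono (by omega)])
  refine ⟨L, by omega, hL₂, fun v g y J X R A x => ?_⟩
  rw [hL]
  have hs : ∀ j, (n : ℝ) * ∑ i, (∑ t, firstRow n t * constBlock n g i t) * constBlock n v i j =
      g ⬝ᵥ v := by
    intro j
    have : (n : ℝ) ≠ 0 := by positivity
    simp only [firstRow_sum hn, Finset.mul_sum, dotProduct, constBlock, Matrix.of_apply]
    refine Finset.sum_congr rfl fun i _ => ?_
    field_simp
  refine eq_tokens ?_ ?_ ?_ ?_ ?_ ?_ ?_ ?_ ?_ ?_ ?_ ?_ <;> intros <;> simp [hs]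

/-- The iterate is updated, and everything else is reset. -/
theorem exists_update_layer (hn : 0 < n) :
    ∃ L : TransformerLayer (BlockRow d), L.heads ≤ 8 ∧
      L.width ≤ Fintype.card (BlockRow d) * 5 ∧
      ∀ (v x : Fin d → ℝ) (t : ℝ) (y z : Fin n → ℝ) (G X R A : Matrix (Fin d) (Fin n) ℝ),
        L.eval (tokens (eyeBlock d n) (constBlock n v) G X R A (constBlock n x)
          (fun _ => t) y (firstRow n) z 1) =
        tokens (eyeBlock d n) (eyeBlock d n) (eyeBlock d n) 0 0 A
          (constBlock n (x - t • v)) 0 y (firstRow n) 0 1 := by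
  obtain ⟨L, hL₁, hL₂, hL⟩ := exists_layer (n := n) (N := 4)
    (isAttention_headMap (-1 / n) (blk (d := d) 6) (blk 1) (row (d := d) (.inr 0)) (row (.inr 4)))
    (g := fun r u => match r with
      | .inl (1, i) => 1 * u (.inl (0, i)) + -1 * u (.inl (1, i))
      | .inl (2, i) => 1 * u (.inl (0, i)) + -1 * u (.inl (2, i))
      | .inl (3, i) => -1 * u (.inl (3, i))
      | .inl (4, i) => -1 * u (.inl (4, i))
      | .inr 0 => -1 * u (.inr 0)
      | .inr 3 => -1 * u (.inr 3)
      | _ => 0) (by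
      intro r
      split
      exacts [((IsReluNet.coord _ _).add (IsReluNet.coord _ _)).mono (by omega),
        ((IsReluNet.coord _ _).add (IsReluNet.coord _ _)).mono (by omega),
        (IsReluNet.coord _ _).mono (by omega), (IsReluNet.coord _ _).mono (by omega),
        (IsReluNet.coord _ _).mono (by omega), (IsReluNet.coord _ _).mono (by omega),
        IsReluNet.zero.mono (by omega)])
  refine ⟨L, by omega, hL₂, fun v x t y z G X R A => ?_⟩
  rw [hL]
  have hn' : (n : ℝ) ≠ 0 := by positivity
  refine eq_tokens ?_ ?_ ?_ ?_ ?_ ?_ ?_ ?_ ?_ ?_ ?_ ?_ <;> intros <;> simp [constBlock]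
  field_simp
  ring

end Layers

/-! ### Composition of the layers -/

section Assembly

variable {d n N : ℕ}

/-- The position of a token coordinate in block form. -/
def toBlockRow (d : ℕ) : TokenRow d → BlockRow d
  | .inl (.inl (p, i)) => .inl (p.castLE (by norm_num), i)
  -- The `2d + 1` rows of zeros serve as scratch space: two blocks of `d` rows and one single row.
  | .inl (.inr r) => if h : (r : ℕ) < d then .inl (3, ⟨r, h⟩)
      else if h' : (r : ℕ) - d < d then .inl (4, ⟨r - d, h'⟩) else .inr 0
  | .inr (.inl (.inl i)) => .inl (5, i)
  | .inr (.inl (.inr i)) => .inl (6, i)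
  | .inr (.inr t) => .inr t.succ

theorem toBlockRow_bijective (d : ℕ) : Function.Bijective (toBlockRow d) := by
  rw [Fintype.bijective_iff_surjective_and_card]
  constructor
  · rintro (⟨b, i⟩ | t)
    · fin_cases b
      · exact ⟨.inl (.inl (0, i)), rfl⟩
      · exact ⟨.inl (.inl (1, i)), rfl⟩
      · exact ⟨.inl (.inl (2, i)), rfl⟩
      · exact ⟨.inl (.inr ⟨i, by omega⟩), by simp [toBlockRow]⟩
      · exact ⟨.inl (.inr ⟨d + i, by omega⟩), by simp [toBlockRow]⟩
      · exact ⟨.inr (.inl (.inl i)), rfl⟩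
      · exact ⟨.inr (.inl (.inr i)), rfl⟩
    · refine Fin.cases ?_ (fun t => ⟨.inr (.inr t), rfl⟩) t
      exact ⟨.inl (.inr ⟨2 * d, by omega⟩), by
        simp only [toBlockRow]; rw [dif_neg (by omega), dif_neg (by omega)]⟩
  · simp
    ring

/-- Token coordinates in block form. -/
noncomputable def blockEquiv (d : ℕ) : TokenRow d ≃ BlockRow d :=
  Equiv.ofBijective _ (toBlockRow_bijective d)

/-- The covariates as the columns of a matrix. -/
def covariates (a : Fin n → EuclideanSpace ℝ (Fin d)) : Matrix (Fin d) (Fin n) ℝ :=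
  Matrix.of fun i j => a j i

theorem tokens_submatrix_blockEquiv (a : Fin n → EuclideanSpace ℝ (Fin d)) (y : Fin n → ℝ)
    (x : EuclideanSpace ℝ (Fin d)) :
    (tokens (eyeBlock d n) (eyeBlock d n) (eyeBlock d n) 0 0 (covariates a) (constBlock n x)
      0 y (firstRow n) 0 1).submatrix (blockEquiv d) id = contextMatrix a y x := by
  ext r j
  rw [Matrix.submatrix_apply]
  change tokens _ _ _ _ _ _ _ _ _ _ _ _ (toBlockRow d r) j = _
  match r with
  | .inl (.inl (p, i)) => fin_cases p <;> rfl
  | .inl (.inr r) =>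
    simp only [toBlockRow, contextMatrix]
    split_ifs <;> rfl
  | .inr (.inl (.inl i)) => rfl
  | .inr (.inl (.inr i)) => rfl
  | .inr (.inr t) => fin_cases t <;> rfl

/-- Repeated squaring layers approximate the inverse of `M`. -/
theorem foldl_squaring (L : TransformerLayer (BlockRow d))
    (hL : ∀ (X R : Matrix (Fin d) (Fin d) ℝ) (M G A x : Matrix (Fin d) (Fin n) ℝ)
        (s₀ s₁ s₂ s₃ s₄ : Fin n → ℝ),
        L.eval (tokens (eyeBlock d n) M G (X * eyeBlock d n) (R * eyeBlock d n) A x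
          s₀ s₁ s₂ s₃ s₄) =
        tokens (eyeBlock d n) M G ((X + X * R.transpose) * eyeBlock d n)
          ((R * R.transpose) * eyeBlock d n) A x s₀ s₁ s₂ s₃ s₄)
    {M R : Matrix (Fin d) (Fin d) ℝ} (hR : R.transpose = R) (m : ℕ)
    {X : Matrix (Fin d) (Fin d) ℝ} (hX : M * X = 1 - R) :
    ∃ Y R' : Matrix (Fin d) (Fin d) ℝ, M * Y = 1 - R ^ 2 ^ m ∧
      ∀ (T G A x : Matrix (Fin d) (Fin n) ℝ) (s₀ s₁ s₂ s₃ s₄ : Fin n → ℝ),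
      (List.replicate m L).foldl (fun H L => L.eval H)
        (tokens (eyeBlock d n) T G (X * eyeBlock d n) (R * eyeBlock d n) A x
          s₀ s₁ s₂ s₃ s₄) =
        tokens (eyeBlock d n) T G (Y * eyeBlock d n) (R' * eyeBlock d n) A x
          s₀ s₁ s₂ s₃ s₄ := by
  induction m generalizing X R with
  | zero => exact ⟨X, R, by simpa using hX, by simp⟩
  | succ m ih =>
    obtain ⟨Y, R', hY, h⟩ := ih (R := R * R) (X := X + X * R) (by rw [Matrix.transpose_mul, hR])
      -- The invariant `M X = 1 - R` is preserved since `M X (1 + R) = (1 - R)(1 + R) = 1 - R²`;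
      -- invertibility of `M` plays no role.
      (by rw [Matrix.mul_add, ← Matrix.mul_assoc, hX]; noncomm_ring)
    refine ⟨Y, R', ?_, fun T G A x s₀ s₁ s₂ s₃ s₄ => ?_⟩
    · rw [hY, ← pow_two, ← pow_mul, pow_succ, mul_comm]
    · rw [List.replicate_succ, List.foldl_cons, hL, hR, h]

/-- The Transformer computing an approximate damped Newton step; `F₁`, `F₂`, `F₃`, `F₄` are the
scalar functions computed by its feed-forward networks. -/
theorem exists_newton_transformer (hd : 0 < d) (hdn : d ≤ n) (hN : 2 ≤ N) (k : ℕ) (μ : ℝ)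
    {F₁ F₂ F₃ F₄ : ℝ → ℝ → ℝ → ℝ}
    (h₁ : ∀ rs ra ro : BlockRow d, IsReluNet N (fun v => F₁ (v rs) (v ra) (v ro)))
    (h₂ : ∀ rs ra ro : BlockRow d, IsReluNet N (fun v => F₂ (v rs) (v ra) (v ro)))
    (h₃ : ∀ rs ra ro : BlockRow d, IsReluNet N (fun v => F₃ (v rs) (v ra) (v ro)))
    (h₄ : ∀ rs ra ro : BlockRow d, IsReluNet N (fun v => F₄ (v rs) (v ra) (v ro)))
    (hF₃ : ∀ s, F₃ s 0 1 = 0) :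
    ∃ T : LinearTransformer (TokenRow d), T.length = 11 + 2 * k ∧
      (∀ L ∈ T, L.width ≤ (7 * d + 5) * (N + 5)) ∧ (∀ L ∈ T, L.heads ≤ 8) ∧
      ∀ (a : Fin n → EuclideanSpace ℝ (Fin d)) (y : Fin n → ℝ) (x : EuclideanSpace ℝ (Fin d))
        (B P : Matrix (Fin d) (Fin n) ℝ) (g : Fin d → ℝ) (M : Matrix (Fin d) (Fin d) ℝ) (α : ℝ),
        (B = Matrix.of fun i j => F₁ ((covariates a).transpose.mulVec x j) (a j i) 1) →
        (P = Matrix.of fun i j => F₂ ((covariates a).transpose.mulVec x j) (a j i) 1) →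
        (g = fun i => μ * x i + 1 / n * ∑ j, (P i j - (1 + y j) / 2 * a j i)) →
        (M = μ • (1 : Matrix (Fin d) (Fin d) ℝ) + (1 / (2 * n) : ℝ) •
          (B * (covariates a).transpose + covariates a * B.transpose)) →
        (α = F₃ (1 / n * ∑ j, B ⟨0, hd⟩ j * a j ⟨0, hd⟩) 1 1) →
        ∃ X : Matrix (Fin d) (Fin d) ℝ, M * X = 1 - (1 - α • M) ^ 2 ^ (2 * k) ∧
          T.eval (contextMatrix a y x) = contextMatrix a y
            (x - F₄ (g ⬝ᵥ X.mulVec g) 1 1 • WithLp.toLp 2 (X.mulVec g)) := by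
  have hn : 0 < n := by omega
  obtain ⟨L₁, a₁, b₁, c₁⟩ := exists_margin_layer hn hN h₁ h₂
  obtain ⟨L₂, a₂, b₂, c₂⟩ := exists_gradient_layer hd hdn hN μ hF₃ h₃
  obtain ⟨L₃, a₃, b₃, c₃⟩ := exists_residual_layer hdn
  obtain ⟨L₄, a₄, b₄, c₄⟩ := exists_squaring_layer hdn
  obtain ⟨L₅, a₅, b₅, c₅⟩ := exists_direction_layer hdn
  obtain ⟨L₆, a₆, b₆, c₆⟩ := exists_decrement_layer hn h₄
  obtain ⟨L₇, a₇, b₇, c₇⟩ := exists_update_layer (d := d) hn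
  obtain ⟨L₀, a₀, b₀, c₀⟩ := exists_identity_layer (BlockRow d) n
  -- Six layers besides the `2k` squarings do the work; five identity layers bring the depth to
  -- exactly `11 + 2k`.
  let T : LinearTransformer (BlockRow d) :=
    [L₀, L₀, L₀, L₀, L₀, L₁, L₂, L₃] ++ (List.replicate (2 * k) L₄ ++ [L₅, L₆, L₇])
  have hcard : Fintype.card (BlockRow d) = 7 * d + 5 := by simp
  rw [hcard] at b₀ b₁ b₂ b₃ b₄ b₅ b₆ b₇
  have hT : ∀ L ∈ T, L.width ≤ (7 * d + 5) * (N + 5) ∧ L.heads ≤ 8 := by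
    have hw : (7 * d + 5) * 5 ≤ (7 * d + 5) * (N + 5) := Nat.mul_le_mul_left _ (by omega)
    have e₀ : L₀.width ≤ (7 * d + 5) * (N + 5) ∧ L₀.heads ≤ 8 :=
      ⟨b₀.trans (Nat.le_mul_of_pos_right _ (by omega)), a₀.trans (by norm_num)⟩
    have e₁ : L₁.width ≤ (7 * d + 5) * (N + 5) ∧ L₁.heads ≤ 8 := ⟨b₁, a₁⟩
    have e₂ : L₂.width ≤ (7 * d + 5) * (N + 5) ∧ L₂.heads ≤ 8 := ⟨b₂, a₂⟩
    have e₃ : L₃.width ≤ (7 * d + 5) * (N + 5) ∧ L₃.heads ≤ 8 := ⟨b₃.trans hw, a₃⟩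
    have e₄ : L₄.width ≤ (7 * d + 5) * (N + 5) ∧ L₄.heads ≤ 8 := ⟨b₄.trans hw, a₄⟩
    have e₅ : L₅.width ≤ (7 * d + 5) * (N + 5) ∧ L₅.heads ≤ 8 := ⟨b₅.trans hw, a₅⟩
    have e₆ : L₆.width ≤ (7 * d + 5) * (N + 5) ∧ L₆.heads ≤ 8 := ⟨b₆, a₆⟩
    have e₇ : L₇.width ≤ (7 * d + 5) * (N + 5) ∧ L₇.heads ≤ 8 := ⟨b₇.trans hw, a₇⟩
    simp only [T, List.forall_mem_append, List.forall_mem_cons]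
    refine ⟨⟨e₀, e₀, e₀, e₀, e₀, e₁, e₂, e₃, by simp⟩, fun L hL => ?_, e₅, e₆, e₇, by simp⟩
    rwa [List.eq_of_mem_replicate hL]
  refine ⟨T.map (TransformerLayer.reindex (blockEquiv d)), ?_, ?_, ?_, ?_⟩
  · simp [T]; ring
  · intro L hL
    obtain ⟨L', hL', rfl⟩ := List.mem_map.1 hL
    rw [TransformerLayer.reindex_width]
    exact (hT L' hL').1
  · intro L hL
    obtain ⟨L', hL', rfl⟩ := List.mem_map.1 hL
    exact (hT L' hL').2
  · intro a y x B P g M α hB hP hg hM hα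
    have hMt : M.transpose = M := by
      rw [hM]
      simp [Matrix.transpose_mul, add_comm]
    obtain ⟨X, R, hX, hfold⟩ := foldl_squaring L₄ c₄ (M := M) (R := 1 - α • M.transpose)
      (by simp [hMt]) (2 * k) (X := α • 1) (by simp [hMt])
    refine ⟨X, by simpa [hMt] using hX, ?_⟩
    rw [← tokens_submatrix_blockEquiv, LinearTransformer.reindex_eval,
      ← tokens_submatrix_blockEquiv]
    congr 1
    simp only [LinearTransformer.eval, T, List.foldl_append, List.foldl_cons, List.foldl_nil,
      c₀, c₁, c₂]
    have hB' : (Matrix.of fun i j => F₁ ((covariates a).transpose.mulVec x j)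
      (covariates a i j) 1) = B := hB.symm
    have hP' : (Matrix.of fun i j => F₂ ((covariates a).transpose.mulVec x j)
      (covariates a i j) 1) = P := hP.symm
    have hα' : F₃ (1 / n * ∑ j, B ⟨0, hd⟩ j * covariates a ⟨0, hd⟩ j) 1 1 = α := hα.symm
    have hg' : (fun i => μ * x i + 1 / n * ∑ j, (P i j - (1 + y j) / 2 * covariates a i j)) = g :=
      hg.symm
    rw [hB', hP', hα', hg', ← hM, c₃, hfold, c₅, c₆, c₇]
    rfl

end Assembly

/-! ### Positive operators, the initial residual and perturbation of the Newton direction -/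

section Operators

variable {E : Type*} [NormedAddCommGroup E] [InnerProductSpace ℝ E] {T A B X ρ : E →L[ℝ] E}

/-- Cauchy–Schwarz for a positive semidefinite form: the quadratic `t ↦ ⟪T (u + t v), u + t v⟫` is
nonnegative, so its discriminant is not positive. -/
theorem inner_sq_le_of_nonneg (hT : ∀ u v, ⟪T u, v⟫ = ⟪u, T v⟫) (h0 : ∀ u, 0 ≤ ⟪T u, u⟫)
    (u v : E) : ⟪T u, v⟫ ^ 2 ≤ ⟪T u, u⟫ * ⟪T v, v⟫ := by
  have h : ∀ t : ℝ, 0 ≤ ⟪T v, v⟫ * (t * t) + 2 * ⟪T u, v⟫ * t + ⟪T u, u⟫ := by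
    intro t
    have h1 := h0 (u + t • v)
    have h2 : ⟪T v, u⟫ = ⟪T u, v⟫ := by rw [hT, real_inner_comm]
    simp only [map_add, map_smul, inner_add_left, inner_add_right, real_inner_smul_left,
      real_inner_smul_right, h2] at h1
    linarith
  have := discrim_le_zero h
  rw [discrim] at this
  linarith

/-- Taking `v = T u` in Cauchy–Schwarz gives `‖T u‖⁴ ≤ ⟪T u, u⟫ ⟪T (T u), T u⟫ ≤ c² ‖u‖² ‖T u‖²`.
This gives norm bounds from quadratic forms without diagonalization. -/
theorem norm_le_of_inner_le {c : ℝ} (hc : 0 ≤ c) (hT : ∀ u v, ⟪T u, v⟫ = ⟪u, T v⟫)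
    (h0 : ∀ u, 0 ≤ ⟪T u, u⟫) (h1 : ∀ u, ⟪T u, u⟫ ≤ c * ‖u‖ ^ 2) : ‖T‖ ≤ c := by
  refine T.opNorm_le_bound hc fun u => ?_
  have h := inner_sq_le_of_nonneg hT h0 u (T u)
  rw [real_inner_self_eq_norm_sq] at h
  have h2 : ⟪T u, u⟫ * ⟪T (T u), T u⟫ ≤ (c * ‖u‖ ^ 2) * (c * ‖T u‖ ^ 2) :=
    mul_le_mul (h1 _) (h1 _) (h0 _) (by positivity)
  rcases eq_or_lt_of_le (norm_nonneg (T u)) with h3 | h3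
  · rw [← h3]; positivity
  · refine le_of_sq_le_sq ?_ (by positivity)
    have h4 : ‖T u‖ ^ 2 * ‖T u‖ ^ 2 ≤ (c * ‖u‖) ^ 2 * ‖T u‖ ^ 2 := by nlinarith
    exact le_of_mul_le_mul_right h4 (by positivity)

theorem isInvertible_of_coercive [FiniteDimensional ℝ E] {μ : ℝ} (hμ : 0 < μ)
    (hA : ∀ u, μ * ‖u‖ ^ 2 ≤ ⟪A u, u⟫) : A.IsInvertible := by
  have hinj : Function.Injective A := by
    rw [injective_iff_map_eq_zero]
    intro u hu
    have := hA u
    rw [hu, inner_zero_left] at this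
    have h2 : ‖u‖ ^ 2 ≤ 0 := by nlinarith
    simpa using h2
  let e := LinearEquiv.ofInjectiveEndo (A : E →ₗ[ℝ] E) hinj
  exact ⟨e.toContinuousLinearEquiv, by ext; rfl⟩

theorem norm_inverse_le [FiniteDimensional ℝ E] {μ : ℝ} (hμ : 0 < μ)
    (hA : ∀ u, μ * ‖u‖ ^ 2 ≤ ⟪A u, u⟫) : ‖A.inverse‖ ≤ 1 / μ := by
  refine ContinuousLinearMap.opNorm_le_bound _ (by positivity) fun w => ?_
  have hi := isInvertible_of_coercive hμ hA
  have h1 := hA (A.inverse w)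
  rw [hi.self_apply_inverse] at h1
  have h2 := real_inner_le_norm w (A.inverse w)
  rcases eq_or_lt_of_le (norm_nonneg (A.inverse w)) with h3 | h3
  · rw [← h3]; positivity
  · rw [div_mul_eq_mul_div, one_mul, le_div_iff₀ hμ]
    refine le_of_mul_le_mul_right ?_ h3
    nlinarith

/-- Cauchy–Schwarz for the form of `A` at `u` and `A⁻¹ u`, whose pairing is `‖u‖²`. It says that `1
/ ‖A⁻¹‖` is a lower bound for `A`, which lets the condition number enter in place of `μ`. -/
theorem sq_norm_le_inverse [FiniteDimensional ℝ E] {μ : ℝ} (hμ : 0 < μ)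
    (hA : ∀ u, μ * ‖u‖ ^ 2 ≤ ⟪A u, u⟫) (hs : ∀ u v, ⟪A u, v⟫ = ⟪u, A v⟫) (u : E) :
    ‖u‖ ^ 2 ≤ ‖A.inverse‖ * ⟪A u, u⟫ := by
  have h := inner_sq_le_of_nonneg hs (fun v => le_trans (by positivity) (hA v)) u
    (A.inverse u)
  have hi := isInvertible_of_coercive hμ hA
  rw [hs, hi.self_apply_inverse, real_inner_self_eq_norm_sq] at h
  have h2 : ⟪u, A.inverse u⟫ ≤ ‖A.inverse‖ * ‖u‖ ^ 2 := by
    calc _ ≤ ‖u‖ * ‖A.inverse u‖ := real_inner_le_norm _ _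
      _ ≤ ‖u‖ * (‖A.inverse‖ * ‖u‖) := by gcongr; exact A.inverse.le_opNorm u
      _ = _ := by ring
  have h0 : 0 ≤ ⟪A u, u⟫ := le_trans (by positivity) (hA u)
  rcases eq_or_lt_of_le (sq_nonneg ‖u‖) with h3 | h3
  · rw [← h3]; positivity
  · refine le_of_mul_le_mul_right ?_ h3
    nlinarith [mul_le_mul_of_nonneg_left h2 h0]

/-- The initial residual is a contraction with rate `1 - 1 / (5 κ²)`. -/
theorem norm_residual_le [FiniteDimensional ℝ E] {μ κ h α : ℝ} {e : E} (hμ : 0 < μ) (hκ : 1 ≤ κ)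
    (hA : ∀ u, μ * ‖u‖ ^ 2 ≤ ⟪A u, u⟫) (hs : ∀ u v, ⟪A u, v⟫ = ⟪u, A v⟫)
    (hc : ‖A‖ * ‖A.inverse‖ ≤ κ) (he : ‖e‖ = 1) (hh : |h - ⟪A e, e⟫| ≤ μ / 4)
    (hα : |α - 1 / (2 * κ) * (1 / h)| ≤ 1 / (2 * κ) * (1 / h) / 4) (hB : ‖B - A‖ ≤ μ / 4) :
    ‖1 - α • B‖ ≤ 1 - 1 / (5 * κ ^ 2) := by
  set a := ⟪A e, e⟫ with ha
  set ν := ‖A.inverse‖ with hν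
  set M := ‖A‖ with hM
  have hM' : ∀ u, ⟪A u, u⟫ ≤ M * ‖u‖ ^ 2 := fun u => by
    calc _ ≤ ‖A u‖ * ‖u‖ := real_inner_le_norm _ _
      _ ≤ (M * ‖u‖) * ‖u‖ := by gcongr; exact A.le_opNorm u
      _ = _ := by ring
  have h1 : μ ≤ a := by simpa [he] using hA e
  have h2 : a ≤ M := by simpa [he] using hM' e
  have h3 : 1 ≤ ν * a := by simpa [he] using sq_norm_le_inverse hμ hA hs e
  have h4 : ν * μ ≤ 1 := by
    have := norm_inverse_le hμ hA
    rwa [le_div_iff₀ hμ] at this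
  have ha0 : 0 < a := by linarith
  have hν0 : 0 < ν := by
    by_contra hcon
    nlinarith
  have hh' := abs_le.1 hh
  have hh0 : 0 < h := by linarith
  have hα' := abs_le.1 hα
  -- As `μ ≤ a`, the scalar `h` lies in `[3a/4, 5a/4]`, so `1 / (2κh)` lies in `[2/5, 2/3] / (κa)`.
  -- The relative error `1/4` of `α` widens this to `[3/10, 5/6] / (κa)`.
  have hα1 : α ≤ 5 / 6 / (κ * a) := by
    have : 1 / (2 * κ) * (1 / h) ≤ 2 / 3 / (κ * a) := by
      rw [div_mul_div_comm, div_le_div_iff₀ (by positivity) (by positivity)]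
      nlinarith
    have e : 5 / 6 / (κ * a) = 5 / 4 * (2 / 3 / (κ * a)) := by ring
    rw [e]; linarith
  have hα2 : 3 / 10 / (κ * a) ≤ α := by
    have : 2 / 5 / (κ * a) ≤ 1 / (2 * κ) * (1 / h) := by
      rw [div_mul_div_comm, div_le_div_iff₀ (by positivity) (by positivity)]
      nlinarith
    have e : 3 / 10 / (κ * a) = 3 / 4 * (2 / 5 / (κ * a)) := by ring
    rw [e]; linarith
  have hα0 : 0 ≤ α := le_trans (by positivity) hα2
  have hM0 : 0 < M := by linarith
  -- From `1 ≤ ν a` and `M ν ≤ κ` follows `M ≤ κ a`. Hence `1 - α A` is positive semidefinite, and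
  -- its norm is controlled by its quadratic form.
  have hαM : α * M ≤ 1 := by
    calc α * M ≤ 5 / 6 / (κ * a) * M := by gcongr
      _ ≤ 1 := by
        rw [div_mul_eq_mul_div, div_le_one (by positivity)]
        nlinarith [mul_le_mul_of_nonneg_left hc ha0.le, mul_le_mul_of_nonneg_left h3 hM0.le]
  have hαν : 3 / 10 / κ ^ 2 ≤ α / ν := by
    refine le_trans ?_ (div_le_div_of_nonneg_right hα2 hν0.le)
    rw [div_div (3 / 10) (κ * a) ν]
    have : a * ν ≤ κ := (mul_le_mul_of_nonneg_right h2 hν0.le).trans hc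
    refine div_le_div_of_nonneg_left (by norm_num) (by positivity) ?_
    calc κ * a * ν = κ * (a * ν) := by ring
      _ ≤ κ * κ := by gcongr
      _ = κ ^ 2 := by ring
  have hμν : μ ≤ 1 / ν := by rw [le_div_iff₀ hν0]; linarith
  have hT : ‖1 - α • A‖ ≤ 1 - α / ν := by
    refine norm_le_of_inner_le ?_ (fun u v => ?_) (fun u => ?_) (fun u => ?_)
    · have : α / ν ≤ α * M := by
        rw [div_le_iff₀ hν0, mul_assoc]
        exact le_mul_of_one_le_right hα0 (by nlinarith)
      linarith
    · simp [inner_sub_left, inner_sub_right, real_inner_smul_left, real_inner_smul_right, hs]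
    · have := mul_le_mul_of_nonneg_left (hM' u) hα0
      simp only [_root_.sub_apply, one_apply_eq_self,
        _root_.smul_apply, inner_sub_left, real_inner_smul_left,
        real_inner_self_eq_norm_sq]
      nlinarith [sq_nonneg ‖u‖]
    · have := mul_le_mul_of_nonneg_left (sq_norm_le_inverse hμ hA hs u) (div_nonneg hα0 hν0.le)
      have e : α / ν * (ν * ⟪A u, u⟫) = α * ⟪A u, u⟫ := by field_simp
      simp only [_root_.sub_apply, one_apply_eq_self,
        _root_.smul_apply, inner_sub_left, real_inner_smul_left,
        real_inner_self_eq_norm_sq]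
      rw [← hν, e] at this
      linarith
  have hsplit : 1 - α • B = (1 - α • A) - α • (B - A) := by rw [smul_sub]; abel
  calc ‖1 - α • B‖ ≤ ‖1 - α • A‖ + ‖α • (B - A)‖ := by rw [hsplit]; exact norm_sub_le _ _
    _ ≤ (1 - α / ν) + α * (μ / 4) := by
        rw [norm_smul, Real.norm_of_nonneg hα0]
        gcongr
    -- Replacing `A` by `B` costs at most a quarter of the gain `α / ν`, because `μ ≤ 1 / ν`. The
    -- remaining `(3/4)(3/10) = 9/40` exceeds `1/5`.
    _ ≤ (1 - α / ν) + α * (1 / ν / 4) := by gcongr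
    _ = 1 - 3 / 4 * (α / ν) := by ring
    _ ≤ 1 - 3 / 4 * (3 / 10 / κ ^ 2) := by gcongr
    _ ≤ _ := by
        have : 1 / (5 * κ ^ 2) = 1 / 5 * (1 / κ ^ 2) := by ring
        have h5 : 3 / 10 / κ ^ 2 = 3 / 10 * (1 / κ ^ 2) := by ring
        have h6 : 0 ≤ 1 / κ ^ 2 := by positivity
        rw [this, h5]
        linarith

/-- Perturbation of the Newton direction and decrement. -/
theorem newton_perturbation [FiniteDimensional ℝ E] {μ r η G : ℝ} {g g' : E} (hμ : 0 < μ)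
    (hA : ∀ u, μ * ‖u‖ ^ 2 ≤ ⟪A u, u⟫) (hB : ‖B - A‖ ≤ η) (hη : η ≤ μ / 4) (hη1 : η ≤ 1)
    (hX : B * X = 1 - ρ) (hρ : ‖ρ‖ ≤ r) (hr : r ≤ 1) (hg : ‖g‖ ≤ G) (hG : 1 ≤ G)
    (hgg : ‖g' - g‖ ≤ η) :
    ‖X g'‖ ≤ 6 * G / μ ∧
    ‖X g' - A.inverse g‖ ≤ r * G / μ + 3 * η * G * (1 + μ) / μ ^ 2 ∧
    |⟪g', X g'⟫ - ⟪g, A.inverse g⟫| ≤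
      6 * η * G / μ + G * (r * G / μ + 3 * η * G * (1 + μ) / μ ^ 2) := by
  have hη0 : 0 ≤ η := (norm_nonneg _).trans hB
  have hr0 : 0 ≤ r := (norm_nonneg _).trans hρ
  have hi := isInvertible_of_coercive hμ hA
  have hinv := norm_inverse_le hμ hA
  have hone : ‖(1 : E →L[ℝ] E)‖ ≤ 1 := ContinuousLinearMap.norm_id_le
  have hdiff : X - A.inverse = -(A.inverse * (ρ + (B - A) * X)) := by
    have h1 : A.inverse * A = 1 := hi.inverse_comp_self
    have h2 : A * X = 1 - ρ - (B - A) * X := by rw [← hX]; noncomm_ring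
    calc X - A.inverse = A.inverse * A * X - A.inverse := by rw [h1, one_mul]
      _ = _ := by rw [mul_assoc, h2]; noncomm_ring
  have hXA : ‖X - A.inverse‖ ≤ 1 / μ * (r + η * ‖X‖) := by
    rw [hdiff, norm_neg]
    calc _ ≤ ‖A.inverse‖ * ‖ρ + (B - A) * X‖ := norm_mul_le _ _
      _ ≤ 1 / μ * (r + η * ‖X‖) := by
        gcongr
        refine (norm_add_le _ _).trans (add_le_add hρ ?_)
        exact (norm_mul_le _ _).trans (by gcongr)
  -- The bound on `X - A⁻¹` contains `‖X‖` itself; since `η ≤ μ / 4`, that term is absorbed on the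
  -- left.
  have hXn : ‖X‖ ≤ 3 / μ := by
    have h1 : ‖X‖ ≤ 1 / μ * (r + η * ‖X‖) + 1 / μ := by
      calc ‖X‖ = ‖(X - A.inverse) + A.inverse‖ := by rw [sub_add_cancel]
        _ ≤ _ := (norm_add_le _ _).trans (add_le_add hXA hinv)
    have h2 : η * ‖X‖ ≤ μ / 4 * ‖X‖ := by gcongr
    have h3 : ‖X‖ ≤ (r + 1 + η * ‖X‖) / μ := h1.trans (le_of_eq (by ring))
    rw [le_div_iff₀ hμ] at h3 ⊢
    nlinarith
  have hXA' : ‖X - A.inverse‖ ≤ 1 / μ * (r + η * (3 / μ)) := hXA.trans (by gcongr)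
  have hg' : ‖g'‖ ≤ 2 * G := by
    calc ‖g'‖ = ‖(g' - g) + g‖ := by rw [sub_add_cancel]
      _ ≤ η + G := (norm_add_le _ _).trans (add_le_add hgg hg)
      _ ≤ 2 * G := by linarith
  have hv : ‖X g'‖ ≤ 6 * G / μ := by
    calc ‖X g'‖ ≤ ‖X‖ * ‖g'‖ := X.le_opNorm _
      _ ≤ 3 / μ * (2 * G) := by gcongr
      _ = _ := by ring
  have hvv : ‖X g' - A.inverse g‖ ≤ r * G / μ + 3 * η * G * (1 + μ) / μ ^ 2 := by
    have e : X g' - A.inverse g = X (g' - g) + (X - A.inverse) g := by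
      simp
    calc ‖X g' - A.inverse g‖ ≤ ‖X‖ * ‖g' - g‖ + ‖X - A.inverse‖ * ‖g‖ := by
          rw [e]
          exact (norm_add_le _ _).trans (add_le_add (X.le_opNorm _) ((X - A.inverse).le_opNorm _))
      _ ≤ 3 / μ * η + 1 / μ * (r + η * (3 / μ)) * G := by gcongr
      _ ≤ 3 / μ * (η * G) + 1 / μ * (r + η * (3 / μ)) * G := by
          gcongr
          exact le_mul_of_one_le_right hη0 hG
      _ = _ := by field_simp; ring
  refine ⟨hv, hvv, ?_⟩
  have e : ⟪g', X g'⟫ - ⟪g, A.inverse g⟫ = ⟪g' - g, X g'⟫ + ⟪g, X g' - A.inverse g⟫ := by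
    simp only [inner_sub_left, inner_sub_right]; ring
  rw [e]
  calc _ ≤ |⟪g' - g, X g'⟫| + |⟪g, X g' - A.inverse g⟫| := abs_add_le _ _
    _ ≤ ‖g' - g‖ * ‖X g'‖ + ‖g‖ * ‖X g' - A.inverse g‖ :=
        add_le_add (abs_real_inner_le_norm _ _) (abs_real_inner_le_norm _ _)
    _ ≤ η * (6 * G / μ) + G * (r * G / μ + 3 * η * G * (1 + μ) / μ ^ 2) := by gcongr
    _ = _ := by ring

end Operators

/-! ### Hölder continuity of the damping factor -/

/-- The damping factor as a function of `λ²`. -/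
noncomputable def damping (μ q : ℝ) : ℝ := 2 * √μ / (2 * √μ + √q)

theorem damping_nonneg (μ q : ℝ) : 0 ≤ damping μ q := by unfold damping; positivity

theorem damping_le_one (μ q : ℝ) : damping μ q ≤ 1 :=
  div_le_one_of_le₀ (le_add_of_nonneg_right (Real.sqrt_nonneg q)) (by positivity)

/-- Negative arguments are included, where `√` is `0`: the computed value of `λ²` comes from an
approximate inverse and is not known to be nonnegative. -/
theorem abs_sqrt_sub_sqrt_le (p q : ℝ) : |√p - √q| ≤ √|p - q| := by
  wlog h : q ≤ p generalizing p q
  · rw [abs_sub_comm, abs_sub_comm p]; exact this q p (by linarith)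
  rw [abs_of_nonneg (sub_nonneg.2 (Real.sqrt_le_sqrt h)), abs_of_nonneg (by linarith : 0 ≤ p - q),
    sub_le_iff_le_add]
  rcases le_total q 0 with hq | hq
  · rw [Real.sqrt_eq_zero_of_nonpos hq, add_zero]
    exact Real.sqrt_le_sqrt (by linarith)
  · rw [Real.sqrt_le_left (by positivity), add_sq, Real.sq_sqrt (by linarith), Real.sq_sqrt hq]
    nlinarith [Real.sqrt_nonneg (p - q), Real.sqrt_nonneg q,
      mul_nonneg (Real.sqrt_nonneg (p - q)) (Real.sqrt_nonneg q)]

theorem abs_damping_sub_le {μ : ℝ} (hμ : 0 < μ) (p q : ℝ) :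
    |damping μ p - damping μ q| ≤ √|p - q| / (2 * √μ) := by
  have hs : 0 < √μ := Real.sqrt_pos.2 hμ
  have hp := Real.sqrt_nonneg p
  have hq := Real.sqrt_nonneg q
  have e : damping μ p - damping μ q =
      2 * √μ * (√q - √p) / ((2 * √μ + √p) * (2 * √μ + √q)) := by
    unfold damping
    field_simp
    ring
  rw [e, abs_div, abs_mul, abs_of_pos (by positivity : 0 < 2 * √μ),
    abs_of_pos (by positivity : 0 < (2 * √μ + √p) * (2 * √μ + √q)), abs_sub_comm,
    div_le_div_iff₀ (by positivity) (by positivity)]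
  have h1 := abs_sqrt_sub_sqrt_le p q
  have h2 : (2 * √μ) * (2 * √μ) ≤ (2 * √μ + √p) * (2 * √μ + √q) := by gcongr <;> linarith
  calc 2 * √μ * |√p - √q| * (2 * √μ) = |√p - √q| * ((2 * √μ) * (2 * √μ)) := by ring
    _ ≤ _ := by gcongr

/-! ### Gradient and Hessian of the logistic loss -/

section Calculus

variable {d n : ℕ}

/-- The derivative of the logistic sigmoid. -/
noncomputable def sigmoidDeriv (s : ℝ) : ℝ := Real.sigmoid s * (1 - Real.sigmoid s)

theorem sigmoidDeriv_nonneg (s : ℝ) : 0 ≤ sigmoidDeriv s :=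
  mul_nonneg (Real.sigmoid_nonneg s) (by linarith [Real.sigmoid_le_one s])

theorem sigmoidDeriv_le_one (s : ℝ) : sigmoidDeriv s ≤ 1 :=
  mul_le_one₀ (Real.sigmoid_le_one s) (by linarith [Real.sigmoid_le_one s])
    (by linarith [Real.sigmoid_nonneg s])

theorem abs_sub_le_of_hasDerivAt {f f' : ℝ → ℝ} (hf : ∀ s, HasDerivAt f (f' s) s)
    (hf' : ∀ s, |f' s| ≤ 1) (s t : ℝ) : |f s - f t| ≤ |s - t| := by
  have := Convex.norm_image_sub_le_of_norm_hasDerivWithin_le (f := f) (f' := f') (C := 1)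
    (s := Set.univ) (x := t) (y := s) (fun x _ => (hf x).hasDerivWithinAt)
    (fun x _ => hf' x) convex_univ trivial trivial
  simpa using this

theorem abs_sigmoid_sub_le (s t : ℝ) : |Real.sigmoid s - Real.sigmoid t| ≤ |s - t| :=
  abs_sub_le_of_hasDerivAt Real.hasDerivAt_sigmoid (fun s => by
    exact (abs_of_nonneg (sigmoidDeriv_nonneg s)).trans_le (sigmoidDeriv_le_one s)) s t

theorem abs_sigmoidDeriv_sub_le (s t : ℝ) : |sigmoidDeriv s - sigmoidDeriv t| ≤ |s - t| := by
  refine (le_trans ?_ (abs_sigmoid_sub_le s t))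
  have e : sigmoidDeriv s - sigmoidDeriv t =
      (Real.sigmoid s - Real.sigmoid t) * (1 - Real.sigmoid s - Real.sigmoid t) := by
    unfold sigmoidDeriv; ring
  rw [e, abs_mul]
  refine mul_le_of_le_one_right (abs_nonneg _) (abs_le.2 ⟨?_, ?_⟩) <;>
    linarith [Real.sigmoid_nonneg s, Real.sigmoid_nonneg t, Real.sigmoid_le_one s,
      Real.sigmoid_le_one t]

/-- For `y = ±1` the derivative splits into a sigmoid independent of `y` and a term linear in `y`.
Only the margin passes through a nonlinearity, and the Hessian does not depend on the labels. -/
theorem hasDerivAt_log_one_add_exp {y : ℝ} (hy : y = 1 ∨ y = -1) (s : ℝ) :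
    HasDerivAt (fun s => Real.log (1 + Real.exp (-y * s))) (Real.sigmoid s - (1 + y) / 2) s := by
  have h1 : HasDerivAt (fun s => 1 + Real.exp (-y * s)) (Real.exp (-y * s) * (-y)) s := by
    simpa using (((hasDerivAt_id s).const_mul (-y)).exp).const_add 1
  have hpos : 0 < 1 + Real.exp (-y * s) := by positivity
  convert h1.log hpos.ne' using 1
  rw [Real.sigmoid_def]
  rcases hy with rfl | rfl
  · have : 0 < 1 + Real.exp (-s) := by positivity
    simp only [neg_mul, one_mul]
    field_simp
    ring
  · have : 0 < 1 + Real.exp (-s) := by positivity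
    have h2 : 0 < Real.exp s := Real.exp_pos s
    simp only [neg_neg, one_mul, Real.exp_neg]
    field_simp
    ring

theorem hasFDerivAt_inner_left (a w : EuclideanSpace ℝ (Fin d)) :
    HasFDerivAt (fun w => ⟪w, a⟫) (innerSL ℝ a) w := by
  simpa [real_inner_comm] using (innerSL ℝ a).hasFDerivAt (x := w)

/-- The gradient of the logistic loss. -/
noncomputable def logisticGradient (μ : ℝ) (a : Fin n → EuclideanSpace ℝ (Fin d)) (y : Fin n → ℝ)
    (w : EuclideanSpace ℝ (Fin d)) : EuclideanSpace ℝ (Fin d) :=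
  μ • w + (1 / (n : ℝ)) • ∑ i, (Real.sigmoid ⟪w, a i⟫ - (1 + y i) / 2) • a i

/-- The Hessian of the logistic loss. -/
noncomputable def logisticHessian (μ : ℝ) (a : Fin n → EuclideanSpace ℝ (Fin d))
    (w : EuclideanSpace ℝ (Fin d)) :
    EuclideanSpace ℝ (Fin d) →L[ℝ] EuclideanSpace ℝ (Fin d) :=
  μ • ContinuousLinearMap.id ℝ _ +
    (1 / (n : ℝ)) • ∑ i, (sigmoidDeriv ⟪w, a i⟫ • innerSL ℝ (a i)).smulRight (a i)

variable {μ : ℝ} {a : Fin n → EuclideanSpace ℝ (Fin d)} {y : Fin n → ℝ}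

theorem gradient_logisticLoss (hy : ∀ i, y i = 1 ∨ y i = -1) :
    gradient (logisticLoss μ a y) = logisticGradient μ a y := by
  refine gradient_eq fun w => ?_
  rw [hasGradientAt_iff_hasFDerivAt]
  have h1 : ∀ i, HasFDerivAt (fun w => Real.log (1 + Real.exp (-(y i) * ⟪w, a i⟫)))
      ((Real.sigmoid ⟪w, a i⟫ - (1 + y i) / 2) • innerSL ℝ (a i)) w := fun i => by
    have h := (hasDerivAt_log_one_add_exp (hy i) ⟪w, a i⟫).comp_hasFDerivAt w
      (hasFDerivAt_inner_left (a i) w)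
    exact h
  have h2 := ((HasFDerivAt.fun_sum fun i (_ : i ∈ Finset.univ) => h1 i).const_mul
    (1 / (n : ℝ))).add ((hasStrictFDerivAt_norm_sq w).hasFDerivAt.const_mul (μ / 2))
  refine h2.congr_fderiv ?_
  ext h
  simp [logisticGradient]
  ring

theorem hessian_logisticLoss (hy : ∀ i, y i = 1 ∨ y i = -1) (w : EuclideanSpace ℝ (Fin d)) :
    hessian (logisticLoss μ a y) w = logisticHessian μ a w := by
  rw [hessian, gradient_logisticLoss hy]
  refine HasFDerivAt.fderiv ?_
  refine ((hasFDerivAt_id w).const_smul μ).add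
    (HasFDerivAt.fun_const_smul (HasFDerivAt.fun_sum fun i _ => ?_) _)
  exact (((Real.hasDerivAt_sigmoid ⟪w, a i⟫).comp_hasFDerivAt w
    (hasFDerivAt_inner_left (a i) w)).sub_const _).smul_const (a i)

theorem logisticHessian_apply (w h : EuclideanSpace ℝ (Fin d)) :
    logisticHessian μ a w h =
      μ • h + (1 / (n : ℝ)) • ∑ i, (sigmoidDeriv ⟪w, a i⟫ * ⟪a i, h⟫) • a i := by
  simp [logisticHessian]

theorem inner_logisticHessian (w u v : EuclideanSpace ℝ (Fin d)) :
    ⟪logisticHessian μ a w u, v⟫ =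
      μ * ⟪u, v⟫ + 1 / n * ∑ i, sigmoidDeriv ⟪w, a i⟫ * ⟪a i, u⟫ * ⟪a i, v⟫ := by
  simp [logisticHessian_apply, inner_add_left, real_inner_smul_left, sum_inner]

theorem logisticHessian_symm (w u v : EuclideanSpace ℝ (Fin d)) :
    ⟪logisticHessian μ a w u, v⟫ = ⟪u, logisticHessian μ a w v⟫ := by
  rw [real_inner_comm (logisticHessian μ a w v), inner_logisticHessian, inner_logisticHessian,
    real_inner_comm v]
  congr 2
  exact Finset.sum_congr rfl fun i _ => by ring

theorem logisticHessian_coercive (w u : EuclideanSpace ℝ (Fin d)) :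
    μ * ‖u‖ ^ 2 ≤ ⟪logisticHessian μ a w u, u⟫ := by
  rw [inner_logisticHessian, real_inner_self_eq_norm_sq]
  have : 0 ≤ ∑ i, sigmoidDeriv ⟪w, a i⟫ * ⟪a i, u⟫ * ⟪a i, u⟫ :=
    Finset.sum_nonneg fun i _ => by
      rw [mul_assoc]; exact mul_nonneg (sigmoidDeriv_nonneg _) (mul_self_nonneg _)
  have : 0 ≤ 1 / (n : ℝ) * ∑ i, sigmoidDeriv ⟪w, a i⟫ * ⟪a i, u⟫ * ⟪a i, u⟫ := by positivity
  linarith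

/-- The norm of an average of vectors. -/
theorem norm_average_le {E : Type*} [NormedAddCommGroup E] [NormedSpace ℝ E] (hn : 0 < n)
    {v : Fin n → E} {c : ℝ} (hv : ∀ i, ‖v i‖ ≤ c) : ‖(1 / (n : ℝ)) • ∑ i, v i‖ ≤ c := by
  have hn' : (0 : ℝ) < n := by exact_mod_cast hn
  rw [norm_smul, Real.norm_of_nonneg (by positivity), one_div, inv_mul_le_iff₀ hn']
  calc _ ≤ ∑ i, ‖v i‖ := norm_sum_le _ _
    _ ≤ ∑ _i : Fin n, c := Finset.sum_le_sum fun i _ => hv i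
    _ = _ := by simp

theorem norm_logisticHessian_le (hn : 0 < n) (hμ : 0 < μ) (ha : ∀ i, ‖a i‖ ≤ 1)
    (w : EuclideanSpace ℝ (Fin d)) : ‖logisticHessian μ a w‖ ≤ μ + 1 := by
  refine (norm_add_le _ _).trans (add_le_add ?_ (norm_average_le hn fun i => ?_))
  · rw [norm_smul, Real.norm_of_nonneg hμ.le]
    exact mul_le_of_le_one_right hμ.le ContinuousLinearMap.norm_id_le
  · rw [ContinuousLinearMap.norm_smulRight_apply, norm_smul, innerSL_apply_norm,
      Real.norm_of_nonneg (sigmoidDeriv_nonneg _)]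
    have := ha i
    have := sigmoidDeriv_le_one ⟪w, a i⟫
    have := sigmoidDeriv_nonneg ⟪w, a i⟫
    exact mul_le_one₀ (mul_le_one₀ ‹_› (norm_nonneg _) ‹_›) (norm_nonneg _) ‹_›

/-- A real supremum bounds its family only if the family is bounded above; here `(μ + 1) / μ` is a
uniform bound. -/
theorem conditionNumber_le (hn : 0 < n) (hμ : 0 < μ) (ha : ∀ i, ‖a i‖ ≤ 1)
    (hy : ∀ i, y i = 1 ∨ y i = -1) {κ : ℝ} (hκ : lossConditionNumber (logisticLoss μ a y) ≤ κ)
    (w : EuclideanSpace ℝ (Fin d)) :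
    ‖logisticHessian μ a w‖ * ‖(logisticHessian μ a w).inverse‖ ≤ κ := by
  refine le_trans ?_ hκ
  have hb : BddAbove (Set.range fun x => conditionNumber (hessian (logisticLoss μ a y) x)) := by
    refine ⟨(μ + 1) * (1 / μ), ?_⟩
    rintro _ ⟨x, rfl⟩
    simp only [hessian_logisticLoss hy, conditionNumber]
    exact mul_le_mul (norm_logisticHessian_le hn hμ ha x)
      (norm_inverse_le hμ (logisticHessian_coercive x)) (norm_nonneg _) (by positivity)
  have := le_ciSup hb w
  rwa [hessian_logisticLoss hy] at this

theorem norm_logisticGradient_le (hn : 0 < n) (hμ : 0 < μ) (ha : ∀ i, ‖a i‖ ≤ 1)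
    (hy : ∀ i, y i = 1 ∨ y i = -1) {C : ℝ} {w : EuclideanSpace ℝ (Fin d)} (hw : ‖w‖ ≤ C) :
    ‖logisticGradient μ a y w‖ ≤ 1 + μ * C := by
  rw [add_comm 1]
  refine (norm_add_le _ _).trans (add_le_add ?_ (norm_average_le hn fun i => ?_))
  · rw [norm_smul, Real.norm_of_nonneg hμ.le]
    gcongr
  · rw [norm_smul]
    refine mul_le_one₀ ?_ (norm_nonneg _) (ha i)
    rw [Real.norm_eq_abs, abs_le]
    have := Real.sigmoid_nonneg ⟪w, a i⟫
    have := Real.sigmoid_le_one ⟪w, a i⟫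
    rcases hy i with h | h <;> rw [h] <;> constructor <;> linarith

theorem dampedNewtonStep_logisticLoss (hy : ∀ i, y i = 1 ∨ y i = -1)
    (w : EuclideanSpace ℝ (Fin d)) :
    dampedNewtonStep μ (logisticLoss μ a y) w = w - damping μ ⟪logisticGradient μ a y w,
      (logisticHessian μ a w).inverse (logisticGradient μ a y w)⟫ •
      (logisticHessian μ a w).inverse (logisticGradient μ a y w) := by
  simp only [dampedNewtonStep, newtonDecrement, newtonDirection, gradient_logisticLoss hy,
    hessian_logisticLoss hy, damping]

end Calculus

/-! ### Accuracy of the computed Newton step -/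

section Accuracy

variable {d n : ℕ} {μ η : ℝ} {a : Fin n → EuclideanSpace ℝ (Fin d)} {y : Fin n → ℝ}
  {x : EuclideanSpace ℝ (Fin d)}

/-- Relative errors in the coordinates pass to Euclidean norms without a factor `√d`, so the network
sizes per coordinate do not grow with `d`. -/
theorem norm_le_of_abs_coord_le (hη : 0 ≤ η) {u v : EuclideanSpace ℝ (Fin d)}
    (h : ∀ i, |u i| ≤ η * |v i|) : ‖u‖ ≤ η * ‖v‖ := by
  refine le_of_sq_le_sq ?_ (by positivity)
  rw [mul_pow, EuclideanSpace.real_norm_sq_eq, EuclideanSpace.real_norm_sq_eq, Finset.mul_sum]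
  refine Finset.sum_le_sum fun i _ => ?_
  rw [← sq_abs (u i), ← sq_abs (v i), ← mul_pow]
  exact pow_le_pow_left₀ (abs_nonneg _) (h i) 2

theorem covariates_transpose_mulVec (j : Fin n) :
    (covariates a).transpose.mulVec x j = ⟪x, a j⟫ := by
  simp [covariates, Matrix.mulVec, dotProduct, PiLp.inner_apply]

/-- The columns of a matrix as vectors. -/
def column (B : Matrix (Fin d) (Fin n) ℝ) (j : Fin n) : EuclideanSpace ℝ (Fin d) :=
  WithLp.toLp 2 fun i => B i j

theorem norm_column_sub_le (hη : 0 ≤ η) {φ : ℝ → ℝ} {B : Matrix (Fin d) (Fin n) ℝ}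
    (hB : ∀ i j, |B i j - φ ⟪x, a j⟫ * a j i| ≤ η * |a j i|) (j : Fin n) :
    ‖column B j - φ ⟪x, a j⟫ • a j‖ ≤ η * ‖a j‖ :=
  norm_le_of_abs_coord_le hη fun i => by simpa [column] using hB i j

/-- If `cⱼ` is the error of the `j`-th column of `B`, the operator error is the average of the
symmetrized rank-one operators built from `aⱼ` and `cⱼ`, each of norm at most `‖aⱼ‖ ‖cⱼ‖ ≤ η`. -/
theorem norm_hessian_sub_le (hn : 0 < n) (hη : 0 ≤ η) (ha : ∀ i, ‖a i‖ ≤ 1)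
    {B : Matrix (Fin d) (Fin n) ℝ}
    (hB : ∀ i j, |B i j - sigmoidDeriv ⟪x, a j⟫ * a j i| ≤ η * |a j i|) :
    ‖Matrix.toEuclideanCLM (n := Fin d) (𝕜 := ℝ)
      (μ • (1 : Matrix (Fin d) (Fin d) ℝ) + (1 / (2 * n) : ℝ) •
        (B * (covariates a).transpose + covariates a * B.transpose)) -
      logisticHessian μ a x‖ ≤ η := by
  let c : Fin n → EuclideanSpace ℝ (Fin d) := fun j =>
    column B j - sigmoidDeriv ⟪x, a j⟫ • a j
  have hc : ∀ j, ‖c j‖ ≤ η := fun j => (norm_column_sub_le hη hB j).trans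
    (mul_le_of_le_one_right hη (ha j))
  have key : Matrix.toEuclideanCLM (n := Fin d) (𝕜 := ℝ)
      (μ • (1 : Matrix (Fin d) (Fin d) ℝ) + (1 / (2 * n) : ℝ) •
        (B * (covariates a).transpose + covariates a * B.transpose)) -
      logisticHessian μ a x = (1 / (n : ℝ)) • ∑ j, (1 / 2 : ℝ) •
        ((innerSL ℝ (a j)).smulRight (c j) + (innerSL ℝ (c j)).smulRight (a j)) := by
    ext u i
    have h1 : (B * (covariates a).transpose).mulVec u.ofLp i = ∑ j, B i j * ⟪a j, u⟫ := by
      rw [← Matrix.mulVec_mulVec]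
      simp only [Matrix.mulVec, dotProduct]
      refine Finset.sum_congr rfl fun j _ => ?_
      rw [real_inner_comm]
      congr 1
    have h2 : (covariates a * B.transpose).mulVec u.ofLp i = ∑ j, a j i * ⟪column B j, u⟫ := by
      rw [← Matrix.mulVec_mulVec]
      simp only [Matrix.mulVec, dotProduct]
      refine Finset.sum_congr rfl fun j _ => ?_
      congr 1
      simp [column, PiLp.inner_apply, mul_comm]
    have h3 : (Matrix.toEuclideanCLM (n := Fin d) (𝕜 := ℝ)
      (μ • (1 : Matrix (Fin d) (Fin d) ℝ) + (1 / (2 * n) : ℝ) •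
        (B * (covariates a).transpose + covariates a * B.transpose)) u) i =
        μ * u i + 1 / (2 * n) * (∑ j, B i j * ⟪a j, u⟫ + ∑ j, a j i * ⟪column B j, u⟫) := by
      rw [Matrix.ofLp_toEuclideanCLM, ← h1, ← h2]
      simp [Matrix.add_mulVec, Matrix.smul_mulVec]
      ring
    have h4 : ∑ j, B i j * ⟪a j, u⟫ + ∑ j, a j i * ⟪column B j, u⟫ =
        2 * ∑ j, sigmoidDeriv ⟪x, a j⟫ * ⟪a j, u⟫ * a j i +
          ∑ j, (⟪a j, u⟫ * c j i + ⟪c j, u⟫ * a j i) := by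
      rw [Finset.mul_sum, ← Finset.sum_add_distrib, ← Finset.sum_add_distrib]
      refine Finset.sum_congr rfl fun j _ => ?_
      simp [c, inner_sub_left, real_inner_smul_left, column]
      ring
    rw [_root_.sub_apply, PiLp.sub_apply, h3, h4, logisticHessian_apply]
    simp
    simp only [← mul_add, ← Finset.mul_sum]
    ring
  rw [key]
  refine norm_average_le hn fun j => ?_
  rw [norm_smul]
  calc _ ≤ ‖(1 / 2 : ℝ)‖ * (‖a j‖ * ‖c j‖ + ‖c j‖ * ‖a j‖) := by
        gcongr
        refine (norm_add_le _ _).trans (le_of_eq ?_)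
        rw [ContinuousLinearMap.norm_smulRight_apply, ContinuousLinearMap.norm_smulRight_apply,
          innerSL_apply_norm, innerSL_apply_norm]
    _ = ‖a j‖ * ‖c j‖ := by norm_num; ring
    _ ≤ 1 * η := by gcongr; exacts [ha j, hc j]
    _ = η := one_mul η

theorem norm_gradient_sub_le (hn : 0 < n) (hη : 0 ≤ η) (ha : ∀ i, ‖a i‖ ≤ 1)
    {P : Matrix (Fin d) (Fin n) ℝ}
    (hP : ∀ i j, |P i j - Real.sigmoid ⟪x, a j⟫ * a j i| ≤ η * |a j i|) :
    ‖WithLp.toLp 2 (fun i => μ * x i + 1 / n * ∑ j, (P i j - (1 + y j) / 2 * a j i)) -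
      logisticGradient μ a y x‖ ≤ η := by
  have key : WithLp.toLp 2 (fun i => μ * x i + 1 / n * ∑ j, (P i j - (1 + y j) / 2 * a j i)) -
      logisticGradient μ a y x =
        (1 / (n : ℝ)) • ∑ j, (column P j - Real.sigmoid ⟪x, a j⟫ • a j) := by
    ext i
    simp [logisticGradient, column, sub_mul, Finset.sum_sub_distrib]
    ring
  rw [key]
  exact norm_average_le hn fun j => (norm_column_sub_le hη hP j).trans
    (mul_le_of_le_one_right hη (ha j))

/-- The accuracy of the computed damped Newton step. -/
theorem norm_newton_step_sub_le (hd : 0 < d) (hn : 0 < n) (hμ : 0 < μ) (hη : 0 ≤ η)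
    (hημ : η ≤ μ / 4) (hη1 : η ≤ 1)
    (ha : ∀ i, ‖a i‖ ≤ 1) (hy : ∀ i, y i = 1 ∨ y i = -1) {κ C G r τ δ : ℝ} (hκ1 : 1 ≤ κ)
    (hκ : lossConditionNumber (logisticLoss μ a y) ≤ κ) (hx : ‖x‖ ≤ C) (hC : 0 ≤ C)
    (hG : G = 1 + μ * C) {m : ℕ} (hr : (1 - 1 / (5 * κ ^ 2)) ^ m ≤ r) (hr1 : r ≤ 1)
    {B P : Matrix (Fin d) (Fin n) ℝ} {g : Fin d → ℝ} {M X : Matrix (Fin d) (Fin d) ℝ}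
    {α t : ℝ}
    (hB : ∀ i j, |B i j - sigmoidDeriv ⟪x, a j⟫ * a j i| ≤ η * |a j i|)
    (hP : ∀ i j, |P i j - Real.sigmoid ⟪x, a j⟫ * a j i| ≤ η * |a j i|)
    (hg : g = fun i => μ * x i + 1 / n * ∑ j, (P i j - (1 + y j) / 2 * a j i))
    (hM : M = μ • (1 : Matrix (Fin d) (Fin d) ℝ) + (1 / (2 * n) : ℝ) •
          (B * (covariates a).transpose + covariates a * B.transpose))
    (hα : ∀ h, h = μ + 1 / n * ∑ j, B ⟨0, hd⟩ j * a j ⟨0, hd⟩ → 3 / 4 * μ ≤ h →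
      h ≤ 2 * (1 + μ) →
      |α - 1 / (2 * κ) * (1 / h)| ≤ 1 / (2 * κ) * (1 / h) / 4)
    (hX : M * X = 1 - (1 - α • M) ^ m)
    (ht : |g ⬝ᵥ X.mulVec g| ≤ 12 * G ^ 2 / μ → |t - damping μ (g ⬝ᵥ X.mulVec g)| ≤ τ)
    (hτ : τ = δ * μ / (24 * G)) (hδ : 0 < δ)
    (hS : 6 * η * G / μ + G * (r * G / μ + 3 * η * G * (1 + μ) / μ ^ 2) ≤
      δ ^ 2 * μ ^ 3 / (144 * G ^ 2))
    (hS' : r * G / μ + 3 * η * G * (1 + μ) / μ ^ 2 ≤ δ / 2) :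
    ‖(x - t • WithLp.toLp 2 (X.mulVec g)) -
      dampedNewtonStep μ (logisticLoss μ a y) x‖ ≤ δ := by
  have hG1 : 1 ≤ G := by
    rw [hG]; have := mul_nonneg hμ.le hC; linarith
  set A := logisticHessian μ a x with hA
  set φ := Matrix.toEuclideanCLM (n := Fin d) (𝕜 := ℝ) with hφ
  have hcoer := logisticHessian_coercive (μ := μ) (a := a) x
  have hsymm := logisticHessian_symm (μ := μ) (a := a) x
  have hMA : ‖φ M - A‖ ≤ η := by rw [hM]; exact norm_hessian_sub_le hn hη ha hB
  have hgg : ‖WithLp.toLp 2 g - logisticGradient μ a y x‖ ≤ η := by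
    rw [hg]; exact norm_gradient_sub_le hn hη ha hP
  have hgG : ‖logisticGradient μ a y x‖ ≤ G := hG ▸ norm_logisticGradient_le hn hμ ha hy hx
  let e : EuclideanSpace ℝ (Fin d) := EuclideanSpace.single ⟨0, hd⟩ 1
  have he : ‖e‖ = 1 := by simp [e]
  set h := μ + 1 / n * ∑ j, B ⟨0, hd⟩ j * a j ⟨0, hd⟩ with hh
  have hMe : ⟪φ M e, e⟫ = h := by
    have h1 : ⟪φ M e, e⟫ = M ⟨0, hd⟩ ⟨0, hd⟩ := by
      simp [e, EuclideanSpace.inner_single_right, hφ, Matrix.ofLp_toEuclideanCLM]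
    rw [h1, hM, hh]
    have hn' : (n : ℝ) ≠ 0 := by positivity
    simp [Matrix.mul_apply, covariates, mul_comm (a _ _)]
    ring
  have hhA : |h - ⟪A e, e⟫| ≤ η := by
    rw [← hMe, ← inner_sub_left, ← _root_.sub_apply]
    refine (abs_real_inner_le_norm _ _).trans ?_
    rw [he, mul_one]
    refine ((φ M - A).le_opNorm e).trans ?_
    rwa [he, mul_one]
  have hAe : μ ≤ ⟪A e, e⟫ := by simpa [he] using hcoer e
  have hAe' : ⟪A e, e⟫ ≤ μ + 1 := by
    refine (real_inner_le_norm _ _).trans ?_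
    rw [he, mul_one]
    refine (A.le_opNorm e).trans ?_
    rw [he, mul_one]
    exact norm_logisticHessian_le hn hμ ha x
  have hhA' := abs_le.1 hhA
  have hres := norm_residual_le hμ hκ1 hcoer hsymm (conditionNumber_le hn hμ ha hy hκ x) he
    (hhA.trans hημ) (hα h rfl (by linarith) (by linarith)) (hMA.trans hημ)
  have hX' : φ M * φ X = 1 - (1 - α • φ M) ^ m := by
    rw [← map_mul, hX, map_sub, map_one, map_pow, map_sub, map_one, map_smul]
  -- Nontriviality of the space gives `‖1‖ = 1`, which makes the norm of a power at most the power
  -- of the norm also for exponent `0`.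
  have hρ : ‖(1 - α • φ M) ^ m‖ ≤ r := by
    have : Nontrivial (EuclideanSpace ℝ (Fin d)) := ⟨e, 0, by
      intro h0; rw [h0] at he; simp at he⟩
    exact (norm_pow_le _ m).trans ((pow_le_pow_left₀ (norm_nonneg _) hres m).trans hr)
  obtain ⟨p1, p2, p3⟩ := newton_perturbation hμ hcoer hMA hημ hη1 hX' hρ hr1 hgG hG1 hgg
  have hv : φ X (WithLp.toLp 2 g) = WithLp.toLp 2 (X.mulVec g) := by
    rw [hφ, Matrix.toEuclideanCLM_toLp]
  have hq : ⟪WithLp.toLp 2 g, φ X (WithLp.toLp 2 g)⟫ = g ⬝ᵥ X.mulVec g := by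
    rw [hv]
    simp [PiLp.inner_apply, dotProduct, mul_comm]
  rw [hq] at p3
  rw [hv] at p1 p2
  have hqle : |g ⬝ᵥ X.mulVec g| ≤ 12 * G ^ 2 / μ := by
    rw [← hq]
    refine (abs_real_inner_le_norm _ _).trans ?_
    have hg2 : ‖WithLp.toLp 2 g‖ ≤ 2 * G := by
      calc ‖WithLp.toLp 2 g‖ = ‖(WithLp.toLp 2 g - logisticGradient μ a y x) +
            logisticGradient μ a y x‖ := by rw [sub_add_cancel]
        _ ≤ η + G := (norm_add_le _ _).trans (add_le_add hgg hgG)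
        _ ≤ 2 * G := by linarith
    rw [hv]
    calc _ ≤ 2 * G * (6 * G / μ) := by gcongr
      _ = _ := by ring
  have ht' := ht hqle
  set q := ⟪logisticGradient μ a y x, A.inverse (logisticGradient μ a y x)⟫ with hqdef
  -- The tolerance `δ² μ³ / (144 G²)` for `λ²` is `μ` times the square of `δ μ / (12 G)`, so the
  -- Hölder bound returns exactly `δ μ / (24 G)`.
  have hdamp : |damping μ (g ⬝ᵥ X.mulVec g) - damping μ q| ≤ δ * μ / (24 * G) := by
    refine (abs_damping_sub_le hμ _ _).trans ?_
    have hsq : √|g ⬝ᵥ X.mulVec g - q| ≤ δ * μ / (12 * G) * √μ := by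
      rw [Real.sqrt_le_left (by positivity)]
      refine (p3.trans hS).trans (le_of_eq ?_)
      rw [mul_pow, Real.sq_sqrt hμ.le]
      field_simp
      norm_num
    have hs : 0 < √μ := Real.sqrt_pos.2 hμ
    rw [div_le_iff₀ (by positivity)]
    refine hsq.trans (le_of_eq ?_)
    field_simp
    norm_num
  rw [dampedNewtonStep_logisticLoss hy, ← hqdef]
  set v := WithLp.toLp 2 (X.mulVec g) with hvdef
  set v' := A.inverse (logisticGradient μ a y x)
  have hsplit : (x - t • v) - (x - damping μ q • v') =
      -((t - damping μ q) • v + damping μ q • (v - v')) := by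
    rw [sub_smul, smul_sub]; abel
  rw [hsplit, norm_neg]
  have htt : |t - damping μ q| ≤ δ * μ / (12 * G) := by
    calc _ ≤ |t - damping μ (g ⬝ᵥ X.mulVec g)| +
          |damping μ (g ⬝ᵥ X.mulVec g) - damping μ q| := abs_sub_le _ _ _
      _ ≤ δ * μ / (24 * G) + δ * μ / (24 * G) := add_le_add (hτ ▸ ht') hdamp
      _ = _ := by field_simp; norm_num
  calc _ ≤ |t - damping μ q| * ‖v‖ + damping μ q * ‖v - v'‖ := by
        refine (norm_add_le _ _).trans ?_
        rw [norm_smul, norm_smul, Real.norm_eq_abs, Real.norm_of_nonneg (damping_nonneg μ q)]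
    -- Half of `δ` pays for the step size, multiplied by `‖v‖ ≤ 6G/μ`, and half for the direction,
    -- multiplied by a damping factor of at most `1`.
    _ ≤ δ * μ / (12 * G) * (6 * G / μ) + 1 * (δ / 2) := by
        gcongr
        · exact damping_le_one μ q
        · exact p2.trans hS'
    _ = δ := by field_simp; norm_num

end Accuracy

/-! ### Choice of the parameters -/

/-- With `l = log₂ Y` and `k = ⌊log₂(κ² l)⌋`, rounding down loses at most a factor `2`, so `4 ·
2^(2k) ≥ κ⁴ l²`. By `l ≥ 60` this is at least `60 κ² l`, and `1 - t ≤ exp (-t)` then gives the decay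
`Y⁻³`. -/
theorem exists_squaring_steps {κ Y : ℝ} (hκ : 1 ≤ κ) (hY : 2 ^ 60 ≤ Y) :
    ∃ k : ℕ, (k : ℝ) ≤ 2 * Real.logb 2 κ + Real.logb 2 (Real.logb 2 Y) ∧
      (1 - 1 / (5 * κ ^ 2)) ^ 2 ^ (2 * k) ≤ 1 / Y ^ 3 := by
  have hY0 : 0 < Y := lt_of_lt_of_le (by positivity) hY
  set l := Real.logb 2 Y with hl
  have hl60 : 60 ≤ l := by
    rw [hl, Real.le_logb_iff_rpow_le (by norm_num) hY0]
    exact_mod_cast hY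
  have hb : 2 * Real.logb 2 κ + Real.logb 2 l = Real.logb 2 (κ ^ 2 * l) := by
    rw [Real.logb_mul (by positivity) (by positivity), Real.logb_pow]
    norm_num
  have hκl : 1 ≤ κ ^ 2 * l := by nlinarith [one_le_pow₀ hκ (n := 2)]
  rw [hb]
  refine ⟨⌊Real.logb 2 (κ ^ 2 * l)⌋₊, Nat.floor_le (Real.logb_nonneg (by norm_num) hκl), ?_⟩
  set k := ⌊Real.logb 2 (κ ^ 2 * l)⌋₊ with hk
  have h1 : κ ^ 2 * l ≤ 2 ^ k * 2 := by
    have h2 := (Nat.lt_floor_add_one (Real.logb 2 (κ ^ 2 * l))).le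
    rw [Real.logb_le_iff_le_rpow (by norm_num) (by positivity)] at h2
    rw [← pow_succ]
    exact_mod_cast h2
  have h2 : κ ^ 4 * l ^ 2 ≤ 4 * 2 ^ (2 * k) := by
    calc κ ^ 4 * l ^ 2 = (κ ^ 2 * l) ^ 2 := by ring
      _ ≤ (2 ^ k * 2) ^ 2 := by gcongr
      _ = _ := by rw [mul_comm 2 k, pow_mul]; ring
  have hlog : Real.log Y ≤ l := by
    have h3 : l * Real.log 2 = Real.log Y := by
      rw [hl, Real.logb, div_mul_cancel₀ _ (Real.log_pos (by norm_num)).ne']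
    have h4 : Real.log 2 ≤ 1 := by linarith [Real.log_two_lt_d9]
    nlinarith
  have hκ2 : 1 ≤ κ ^ 2 := one_le_pow₀ hκ
  have hx : 1 / (5 * κ ^ 2) ≤ 1 := by
    rw [div_le_one (by positivity)]; linarith
  have hmain : 3 * Real.log Y ≤ 2 ^ (2 * k) * (1 / (5 * κ ^ 2)) := by
    rw [mul_one_div, le_div_iff₀ (by positivity)]
    have h5 : 60 * l ≤ l ^ 2 := by nlinarith
    have h6 : κ ^ 2 * (60 * l) ≤ κ ^ 2 * (κ ^ 2 * l ^ 2) :=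
      mul_le_mul_of_nonneg_left (h5.trans (le_mul_of_one_le_left (by positivity) hκ2))
        (by positivity)
    have h7 : κ ^ 2 * Real.log Y ≤ κ ^ 2 * l := by gcongr
    nlinarith
  calc (1 - 1 / (5 * κ ^ 2)) ^ 2 ^ (2 * k)
      ≤ (Real.exp (-(1 / (5 * κ ^ 2)))) ^ 2 ^ (2 * k) :=
        pow_le_pow_left₀ (by linarith) (Real.one_sub_le_exp_neg _) _
    _ = Real.exp (-(2 ^ (2 * k) * (1 / (5 * κ ^ 2)))) := by
        rw [← Real.exp_nat_mul]
        push_cast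
        ring_nf
    _ ≤ Real.exp (-(3 * Real.log Y)) := Real.exp_le_exp.2 (neg_le_neg hmain)
    _ = 1 / Y ^ 3 := by
        rw [Real.exp_neg, one_div, mul_comm, ← Real.rpow_natCast, Real.rpow_def_of_pos hY0]
        norm_num

/-- Truncation at `μ / 2` makes the reciprocal globally Lipschitz, as the gated product requires. It
is inactive for the scales `h ≥ 3μ/4` that occur. -/
theorem abs_one_div_max_sub_le {μ : ℝ} (hμ : 0 < μ) (s t : ℝ) :
    |1 / max (μ + s) (μ / 2) - 1 / max (μ + t) (μ / 2)| ≤ |s - t| * (4 / μ ^ 2) := by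
  set p := max (μ + s) (μ / 2) with hp
  set q := max (μ + t) (μ / 2) with hq
  have h1 : μ / 2 ≤ p := le_max_right _ _
  have h2 : μ / 2 ≤ q := le_max_right _ _
  have hp0 : 0 < p := by linarith
  have hq0 : 0 < q := by linarith
  have h3 : |q - p| ≤ |s - t| := by
    rw [abs_sub_comm s t]
    refine (abs_max_sub_max_le_max _ _ _ _).trans ?_
    simp
  have e : 1 / p - 1 / q = (q - p) / (p * q) := by field_simp
  rw [e, abs_div, abs_of_pos (mul_pos hp0 hq0), div_le_iff₀ (mul_pos hp0 hq0)]
  have h4 : 1 ≤ 4 / μ ^ 2 * (p * q) := by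
    rw [div_mul_eq_mul_div, le_div_iff₀ (by positivity)]
    nlinarith [mul_le_mul h1 h2 (by positivity) hp0.le]
  calc |q - p| ≤ |s - t| * 1 := by simpa using h3
    _ ≤ |s - t| * (4 / μ ^ 2 * (p * q)) := by gcongr
    _ = _ := by ring

set_option maxHeartbeats 1000000 in
/-- The precisions needed by the construction, and the resources they cost. -/
theorem precision_bounds {C μ δ η G r τ : ℝ} (hC : 1 ≤ C) (hμ : 0 < μ) (hδ : 0 < δ)
    (hδ' : δ * (1 + μ) * (2 ^ 30 * C) ≤ 1) (hG : G = 1 + μ * C)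
    (hη : η = δ ^ 2 * μ ^ 5 / (1728 * G ^ 4 * (1 + μ)))
    (hr : r = δ ^ 2 * μ ^ 4 / (576 * G ^ 4)) (hτ : τ = δ * μ / (24 * G)) :
    η ≤ μ / 4 ∧ η ≤ 1 ∧ r ≤ 1 ∧
    6 * η * G / μ + G * (r * G / μ + 3 * η * G * (1 + μ) / μ ^ 2) ≤
      δ ^ 2 * μ ^ 3 / (144 * G ^ 2) ∧
    r * G / μ + 3 * η * G * (1 + μ) / μ ^ 2 ≤ δ / 2 ∧
    2 ^ 60 ≤ (1 + μ) ^ 3 / (δ ^ 2 * μ ^ 2) ∧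
    1 / ((1 + μ) ^ 3 / (δ ^ 2 * μ ^ 2)) ^ 3 ≤ r ∧
    2 * C / η ≤ 3456 * C ^ 5 * ((1 + μ) ^ 8 / (δ ^ 4 * μ ^ 10)) ∧
    (2 + μ + μ / 4) / (μ ^ 2 / (32 * (1 + μ))) ≤ 72 * ((1 + μ) ^ 8 / (δ ^ 4 * μ ^ 10)) ∧
    (2 * (12 * G ^ 2 / μ)) / (4 * μ * τ ^ 2) ≤
      3456 * C ^ 5 * ((1 + μ) ^ 8 / (δ ^ 4 * μ ^ 10)) ∧
    1 ≤ (1 + μ) ^ 8 / (δ ^ 4 * μ ^ 10) := by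
  set g := 1 + μ with hg
  have hg0 : 0 < g := by linarith
  have hG0 : 0 < G := by rw [hG]; positivity
  have hgG : g ≤ G := by rw [hG, hg]; nlinarith
  have hGC : G ≤ C * g := by rw [hG, hg]; nlinarith
  have hG1 : 1 ≤ G := by linarith
  have hμG : μ ≤ G := by linarith
  -- All quantities are monomials in `p`, `s` and `g`.
  set p := 1 / (δ * g) with hp
  set s := g / μ with hs
  have hpC : 2 ^ 30 * C ≤ p := by
    rw [hp, le_div_iff₀ (by positivity)]; linarith
  have hp30 : 2 ^ 30 ≤ p := le_trans (by nlinarith) hpC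
  have hp1 : 1 ≤ p := le_trans (by norm_num) hp30
  have hs1 : 1 ≤ s := by rw [hs, one_le_div hμ]; linarith
  have hg1 : 1 ≤ g := by linarith
  have hp4 : 1 ≤ p ^ 4 := one_le_pow₀ hp1
  have hg2 : 1 ≤ g ^ 2 := one_le_pow₀ hg1
  have hs2 : s ^ 2 ≤ s ^ 10 := pow_le_pow_right₀ hs1 (by norm_num)
  have hδ1 : δ ≤ 1 := by
    have h1 : δ * g * 1 ≤ δ * g * (2 ^ 30 * C) := by
      gcongr; nlinarith
    nlinarith
  have hW : g ^ 8 / (δ ^ 4 * μ ^ 10) = p ^ 4 * s ^ 10 * g ^ 2 := by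
    rw [hp, hs]; field_simp
  have hY : g ^ 3 / (δ ^ 2 * μ ^ 2) = p ^ 2 * s ^ 2 * g ^ 3 := by
    rw [hp, hs]; field_simp
  have hμ4 : μ ^ 4 ≤ G ^ 4 := by gcongr
  have hμ3 : μ ^ 3 ≤ G ^ 3 := by gcongr
  have hδδ : δ ^ 2 ≤ δ := by nlinarith
  have hηle : η ≤ μ / 1728 := by
    rw [hη, div_le_div_iff₀ (by positivity) (by positivity)]
    calc δ ^ 2 * μ ^ 5 * 1728 = δ ^ 2 * μ ^ 4 * (μ * 1728) := by ring
      _ ≤ 1 * G ^ 4 * (μ * 1728) := by gcongr; linarith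
      _ = 1 * (μ * (1728 * G ^ 4)) := by ring
      _ ≤ g * (μ * (1728 * G ^ 4)) := by gcongr
      _ = _ := by ring
  have hη1 : η ≤ 1 := by
    rw [hη, div_le_one (by positivity)]
    calc δ ^ 2 * μ ^ 5 = δ ^ 2 * μ ^ 4 * μ := by ring
      _ ≤ 1 * G ^ 4 * g := by gcongr <;> linarith
      _ ≤ 1728 * G ^ 4 * g := by gcongr; norm_num
  have hr1 : r ≤ 1 := by
    rw [hr, div_le_one (by positivity)]
    calc δ ^ 2 * μ ^ 4 ≤ 1 * G ^ 4 := by gcongr; linarith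
      _ ≤ 576 * G ^ 4 := by gcongr; norm_num
  -- The two contributions to the error of the direction.
  have e1 : r * G / μ = δ ^ 2 * μ ^ 3 / (144 * G ^ 2) / G / 4 := by
    rw [hr]; field_simp; norm_num
  have e2 : 3 * η * G * g / μ ^ 2 = δ ^ 2 * μ ^ 3 / (144 * G ^ 2) / G / 4 := by
    rw [hη]; field_simp; norm_num
  have e3 : 6 * η * G / μ ≤ δ ^ 2 * μ ^ 3 / (144 * G ^ 2) / 2 := by
    have : 6 * η * G / μ = δ ^ 2 * μ ^ 3 / (144 * G ^ 2) / 2 * (μ / (G * g)) := by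
      rw [hη]; field_simp; norm_num
    rw [this]
    refine mul_le_of_le_one_right (by positivity) ?_
    rw [div_le_one (by positivity)]
    nlinarith
  have hSG : δ ^ 2 * μ ^ 3 / (144 * G ^ 2) / G ≤ δ := by
    rw [div_div, div_le_iff₀ (by positivity)]
    calc δ ^ 2 * μ ^ 3 ≤ δ * G ^ 3 := by gcongr
      _ ≤ 144 * (δ * G ^ 3) := le_mul_of_one_le_left (by positivity) (by norm_num)
      _ = δ * (144 * G ^ 2 * G) := by ring
  have hS0 : 0 ≤ δ ^ 2 * μ ^ 3 / (144 * G ^ 2) := by positivity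
  refine ⟨by linarith, hη1, hr1, ?_, ?_, ?_, ?_, ?_, ?_, ?_, ?_⟩
  · rw [e1, e2]
    have : G * (δ ^ 2 * μ ^ 3 / (144 * G ^ 2) / G / 4 + δ ^ 2 * μ ^ 3 / (144 * G ^ 2) / G / 4) =
        δ ^ 2 * μ ^ 3 / (144 * G ^ 2) / 2 := by field_simp; norm_num
    linarith
  · rw [e1, e2]; linarith
  · rw [hY]
    calc (2 : ℝ) ^ 60 = (2 ^ 30) ^ 2 * 1 ^ 2 * 1 ^ 3 := by norm_num
      _ ≤ _ := by gcongr
  · rw [hY, hr, div_le_div_iff₀ (by positivity) (by positivity)]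
    have e4 : δ ^ 2 * μ ^ 4 * (p ^ 2 * s ^ 2 * g ^ 3) ^ 3 = p ^ 4 * s ^ 2 * g ^ 11 := by
      rw [hp, hs]; field_simp
    rw [e4]
    calc 1 * (576 * G ^ 4) ≤ (2 ^ 30) ^ 4 * (C * g) ^ 4 := by
          rw [one_mul]; gcongr; norm_num
      _ = (2 ^ 30 * C) ^ 4 * 1 ^ 2 * g ^ 4 := by ring
      _ ≤ p ^ 4 * s ^ 2 * g ^ 11 := by
        gcongr
        norm_num
  · rw [hW]
    have e5 : 2 * C / η = 3456 * C * (G / g) ^ 4 * (p ^ 2 * s ^ 5 * g ^ 2) := by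
      rw [hη, hp, hs]; field_simp; norm_num
    rw [e5]
    have h1 : G / g ≤ C := by rwa [div_le_iff₀ hg0]
    calc _ ≤ 3456 * C * C ^ 4 * (p ^ 4 * s ^ 10 * g ^ 2) := by
          gcongr <;> first | assumption | norm_num
      _ = _ := by ring
  · rw [hW]
    have e6 : (2 + μ + μ / 4) / (μ ^ 2 / (32 * g)) = 32 * ((2 + μ + μ / 4) / g) * (1 * s ^ 2 * 1) := by
      rw [hs]; field_simp
    rw [e6]
    have h1 : (2 + μ + μ / 4) / g ≤ 9 / 4 := by rw [div_le_iff₀ hg0]; linarith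
    calc _ ≤ 32 * (9 / 4) * (p ^ 4 * s ^ 10 * g ^ 2) := by
          gcongr
      _ = _ := by ring
  · rw [hW]
    have e7 : (2 * (12 * G ^ 2 / μ)) / (4 * μ * τ ^ 2) =
        3456 * (G / g) ^ 4 * (p ^ 2 * s ^ 4 * g ^ 2) := by
      rw [hτ, hp, hs]; field_simp; norm_num
    rw [e7]
    have h1 : G / g ≤ C := by rwa [div_le_iff₀ hg0]
    calc _ ≤ 3456 * C ^ 4 * (p ^ 4 * s ^ 10 * g ^ 2) := by
          gcongr <;> first | assumption | norm_num
      _ ≤ 3456 * C ^ 5 * (p ^ 4 * s ^ 10 * g ^ 2) := by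
          gcongr <;> first | assumption | norm_num
  · rw [hW]
    exact one_le_mul_of_one_le_of_one_le (one_le_mul_of_one_le_of_one_le hp4 (one_le_pow₀ hs1)) hg2

theorem mainTheorem3 (C : ℝ) (hC : 0 < C) :
    ∃ K > (0 : ℝ), ∃ ε₀ > (0 : ℝ),
      ∀ (d n : ℕ), 0 < d → d ≤ n →
      ∀ μ > (0 : ℝ), ∀ κ ≥ (1 : ℝ), ∀ ε > (0 : ℝ),
      ∀ δ : ℝ, δ = min ε (ε₀ / (1 + μ)) →
      ∃ (T : LinearTransformer (TokenRow d)) (k : ℕ),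
        T.length = 11 + 2 * k ∧
        (k : ℝ) ≤ 2 * Real.logb 2 κ
          + Real.logb 2 (Real.logb 2 ((1 + μ) ^ 3 / (δ ^ 2 * μ ^ 2))) ∧
        (∀ L ∈ T, (L.width : ℝ) ≤ K * (d * ((1 + μ) ^ 8 / (δ ^ 4 * μ ^ 10)))) ∧
        (∀ L ∈ T, (L.heads : ℝ) ≤ K) ∧
        ∀ (a : Fin n → EuclideanSpace ℝ (Fin d)) (y : Fin n → ℝ)
          (x₀ : EuclideanSpace ℝ (Fin d)),
          (∀ i, ‖a i‖ ≤ 1) → (∀ i, y i = 1 ∨ y i = -1) →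
          lossConditionNumber (logisticLoss μ a y) ≤ κ → ‖x₀‖ ≤ C →
          ∃ x₁ : EuclideanSpace ℝ (Fin d),
            T.eval (contextMatrix a y x₀) = contextMatrix a y x₁ ∧
            ‖x₁ - dampedNewtonStep μ (logisticLoss μ a y) x₀‖ ≤ ε := by
  set C' := max C 1 with hC'
  have hC1 : 1 ≤ C' := le_max_right _ _
  have hC5 : 1 ≤ C' ^ 5 := one_le_pow₀ hC1
  -- Here `168000 = 12 · 14000`: the first factor bounds `7d + 5` by `12 d`, the second covers the
  -- neurons per row. The small `ε₀` makes `1 / (δ (1 + μ)) ≥ 2^30 C'`, which absorbs numerical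
  -- constants and gives `Y ≥ 2^60`.
  refine ⟨168000 * C' ^ 5, by positivity, 1 / (2 ^ 30 * C'), by positivity, ?_⟩
  intro d n hd hdn μ hμ κ hκ ε hε δ hδε
  have hn : 0 < n := by omega
  have hδ : 0 < δ := by rw [hδε]; exact lt_min hε (by positivity)
  have hδle : δ ≤ ε := by rw [hδε]; exact min_le_left _ _
  have hδ' : δ * (1 + μ) * (2 ^ 30 * C') ≤ 1 := by
    have h1 : δ ≤ 1 / (2 ^ 30 * C') / (1 + μ) := by rw [hδε]; exact min_le_right _ _
    rwa [div_div, le_div_iff₀ (by positivity), mul_comm (2 ^ 30 * C'), ← mul_assoc] at h1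
  obtain ⟨G, hG⟩ : ∃ G, G = 1 + μ * C' := ⟨_, rfl⟩
  -- With `S = δ² μ³ / (144 G²)` the tolerance for `λ²`, these values make `r G / μ` and `3 η G (1 +
  -- μ) / μ²` both equal to `S / (4G)`, and `6 η G / μ` at most `S / 2`.
  obtain ⟨η, hη⟩ : ∃ η, η = δ ^ 2 * μ ^ 5 / (1728 * G ^ 4 * (1 + μ)) := ⟨_, rfl⟩
  obtain ⟨r, hr⟩ : ∃ r, r = δ ^ 2 * μ ^ 4 / (576 * G ^ 4) := ⟨_, rfl⟩
  obtain ⟨τ, hτ⟩ : ∃ τ, τ = δ * μ / (24 * G) := ⟨_, rfl⟩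
  obtain ⟨b1, b2, b3, b4, b5, b6, b7, b8, b9, b10, b11⟩ :=
    precision_bounds hC1 hμ hδ hδ' hG hη hr hτ
  have hG0 : 0 < G := by rw [hG]; positivity
  have hη0 : 0 < η := by rw [hη]; positivity
  have hτ0 : 0 < τ := by rw [hτ]; positivity
  obtain ⟨k, hk, hkr⟩ := exists_squaring_steps hκ b6
  obtain ⟨F₁, h₁, -, e₁⟩ := exists_gated_product (φ := sigmoidDeriv) (l := -C') (u := C') hη0
    (fun s t h => (abs_sigmoidDeriv_sub_le s t).trans h)
  obtain ⟨F₂, h₂, -, e₂⟩ := exists_gated_product (φ := Real.sigmoid) (l := -C') (u := C') hη0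
    (fun s t h => (abs_sigmoid_sub_le s t).trans h)
  -- The interval for `s` corresponds to `3μ/4 ≤ μ + s ≤ 2(1 + μ)`. The precision `1 / (8(1 + μ))`
  -- is then at most a quarter of the reciprocal `1 / (μ + s)`.
  obtain ⟨F₃, h₃, z₃, e₃⟩ := exists_gated_product (φ := fun s => 1 / max (μ + s) (μ / 2))
    (l := -(μ / 4)) (u := 2 + μ) (h := μ ^ 2 / (32 * (1 + μ))) (τ := 1 / (8 * (1 + μ)))
    (by positivity) (fun s t h => (abs_one_div_max_sub_le hμ s t).trans (by
      refine (mul_le_mul_of_nonneg_right h (by positivity)).trans (le_of_eq ?_)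
      field_simp
      norm_num))
  -- The mesh `4 μ τ²` is what the Hölder bound needs for precision `τ`, since `√(4 μ τ²) / (2√μ) =
  -- τ`.
  obtain ⟨F₄, h₄, -, e₄⟩ := exists_gated_product (φ := damping μ) (l := -(12 * G ^ 2 / μ))
    (u := 12 * G ^ 2 / μ) (h := 4 * μ * τ ^ 2) (τ := τ) (by positivity)
    (fun s t h => (abs_damping_sub_le hμ s t).trans (by
      have hs : 0 < √μ := Real.sqrt_pos.2 hμ
      rw [div_le_iff₀ (by positivity), Real.sqrt_le_left (by positivity)]
      refine h.trans (le_of_eq ?_)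
      rw [mul_pow, mul_pow, Real.sq_sqrt hμ.le]
      ring))
  set N₁ := ⌊(C' - -C') / η⌋₊ with hN₁
  set N₃ := ⌊(2 + μ - -(μ / 4)) / (μ ^ 2 / (32 * (1 + μ)))⌋₊ with hN₃
  set N₄ := ⌊(12 * G ^ 2 / μ - -(12 * G ^ 2 / μ)) / (4 * μ * τ ^ 2)⌋₊ with hN₄
  set W := (1 + μ) ^ 8 / (δ ^ 4 * μ ^ 10) with hW
  obtain ⟨T, hTlen, hTw, hTh, hT⟩ := exists_newton_transformer hd hdn
    (N := 2 * (N₁ + N₃ + N₄ + 2)) (by omega) k μ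
    (F₁ := F₁) (F₂ := F₂) (F₃ := fun s e o => 1 / (2 * κ) * F₃ s e o) (F₄ := F₄)
    (fun _ _ _ => (h₁ _ _ _).mono (by omega)) (fun _ _ _ => (h₂ _ _ _).mono (by omega))
    (fun _ _ _ => ((h₃ _ _ _).const_mul _).mono (by omega))
    (fun _ _ _ => (h₄ _ _ _).mono (by omega)) (fun s => by rw [z₃, mul_zero])
  refine ⟨T, k, hTlen, hk, fun L hL => ?_, fun L hL => ?_, ?_⟩
  · have c₁ : (N₁ : ℝ) ≤ 3456 * C' ^ 5 * W :=
      (Nat.floor_le (div_nonneg (by linarith) hη0.le)).trans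
        ((le_of_eq (by ring)).trans b8)
    have c₃ : (N₃ : ℝ) ≤ 72 * W :=
      (Nat.floor_le (div_nonneg (by linarith) (by positivity))).trans
        ((le_of_eq (by ring)).trans b9)
    have c₄ : (N₄ : ℝ) ≤ 3456 * C' ^ 5 * W :=
      (Nat.floor_le (div_nonneg (by rw [sub_neg_eq_add]; positivity) (by positivity))).trans
        ((le_of_eq (by ring)).trans b10)
    have hd1 : (1 : ℝ) ≤ d := by exact_mod_cast hd
    have hCW : W ≤ C' ^ 5 * W := le_mul_of_one_le_left (by linarith) hC5
    calc (L.width : ℝ) ≤ ((7 * d + 5) * (2 * (N₁ + N₃ + N₄ + 2) + 5) : ℕ) := by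
          exact_mod_cast hTw L hL
      _ = (7 * d + 5) * (2 * (N₁ + N₃ + N₄ + 2) + 5) := by push_cast; ring
      _ ≤ (12 * d) * (14000 * (C' ^ 5 * W)) := by
          gcongr
          · linarith
          · linarith
      _ = _ := by ring
  · calc (L.heads : ℝ) ≤ 8 := by exact_mod_cast hTh L hL
      _ ≤ _ := by linarith
  · intro a y x ha hy hκf hx
    have hx' : ‖x‖ ≤ C' := hx.trans (le_max_left _ _)
    obtain ⟨X, hX, hTX⟩ := hT a y x _ _ _ _ _ rfl rfl rfl rfl rfl
    refine ⟨_, hTX, le_trans ?_ hδle⟩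
    have hin : ∀ j, -C' ≤ ⟪x, a j⟫ ∧ ⟪x, a j⟫ ≤ C' := fun j => abs_le.1 (by
      refine (abs_real_inner_le_norm _ _).trans ?_
      calc ‖x‖ * ‖a j‖ ≤ C' * 1 := by gcongr; exact ha j
        _ = C' := mul_one _)
    have hco : ∀ i j, |a j i| ≤ 1 := fun i j => by
      rw [← Real.norm_eq_abs]; exact (PiLp.norm_apply_le (a j) i).trans (ha j)
    refine norm_newton_step_sub_le hd hn hμ hη0.le b1 b2 ha hy hκ hκf hx' (by linarith) hG
      (hkr.trans b7) b3 ?_ ?_ rfl rfl ?_ hX ?_ hτ hδ b4 b5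
    · intro i j
      simp only [Matrix.of_apply, covariates_transpose_mulVec]
      exact e₁ _ _ (hin j).1 (hin j).2 (hco i j)
    · intro i j
      simp only [Matrix.of_apply, covariates_transpose_mulVec]
      exact e₂ _ _ (hin j).1 (hin j).2 (hco i j)
    · have hF : ∀ h s, h = μ + s → 3 / 4 * μ ≤ h → h ≤ 2 * (1 + μ) →
          |1 / (2 * κ) * F₃ s 1 1 - 1 / (2 * κ) * (1 / h)| ≤ 1 / (2 * κ) * (1 / h) / 4 := by
        intro h s hh h1 h2
        have h3 := e₃ s 1 (by linarith) (by linarith) (by simp)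
        rw [← hh, max_eq_left (by linarith), mul_one, abs_one, mul_one] at h3
        rw [← mul_sub, abs_mul, mul_div_assoc, abs_of_nonneg (by positivity : 0 ≤ 1 / (2 * κ))]
        gcongr
        refine h3.trans ?_
        rw [div_div, div_le_div_iff₀ (by positivity) (by linarith)]
        linarith
      exact fun h hh => hF h _ hh
    · intro hq
      have h3 := e₄ _ 1 (abs_le.1 hq).1 (abs_le.1 hq).2 (by simp)
      simpa using h3
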